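/- Let $K\subset\mathbb R^2$ be a convex body (a compact convex set with non-empty interior) whose boundary is a simple closed regular curve of class $C^2$, and let $\delta\in(0,\mathrm{Vol}_2(K))$. For every unit vector $\xi$ let $H_\xi$ be the unique line with normal $\xi$, say $H_\xi=\{x:\langle \xi,x\rangle=h(\xi)\}$, such that the half-plane $H_\xi^-=\{x:\langle \xi,x\rangle\le h(\xi)\}$ cuts off from $K$ the area $\delta$, i.e. $\mathrm{Vol}_2(K\cap H_\xi^-)=\delta$. The curve of flotation $\Pi_\delta(K)$ is the envelope of the family of lines $\{H_\xi\}_{\xi\in\mathbb S^1}$, that is, with $\xi(\theta)=(\cos\theta,\sin\theta)$, the set of points $x$ for which there is a $\theta$ such that $\langle\xi(\theta),x\rangle-h(\xi(\theta))$ and its derivative with respect to $\theta$ both vanish. The curve of buoyancy $\Gamma_\delta(K)$ is the set of the centroids of $K\cap H_\xi^-$, $\xi\in\mathbb S^1$. Two sets are called homothetic if there are a point $z$ and a dilation with center $z$ (and ratio a non-zero real number) that maps one set onto the other. If $K$ is not an ellipse (i.e. not the image of the closed unit disc under an invertible affine map), then the set of all $\delta\in(0,\mathrm{Vol}_2(K))$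 for which $\Pi_\delta(K)$ is homothetic to $\Gamma_\delta(K)$ is nowhere dense in $(0,\mathrm{Vol}_2(K))$. -/

import Mathlib

open MeasureTheory Set

namespace Flotation

/-- The Euclidean plane. -/
abbrev Plane : Type := EuclideanSpace ℝ (Fin 2)

/-- The unit vector in the direction of the angle `θ`; it runs through the whole unit circle. -/
noncomputable def dir (θ : ℝ) : Plane := !₂[Real.cos θ, Real.sin θ]

/-- The closed half-plane `{x : ⟨ξ, x⟩ ≤ h}`, bounded by the line `{x : ⟨ξ, x⟩ = h}`. -/
def halfPlane (ξ : Plane) (h : ℝ) : Set Plane := {x | inner ℝ ξ x ≤ h}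

/-- The half-plane with outer normal `ξ` and level `h` cuts off from `K` a set of area `δ`. -/
def CutsOff (K : Set Plane) (δ : ℝ) (ξ : Plane) (h : ℝ) : Prop :=
  volume (K ∩ halfPlane ξ h) = ENNReal.ofReal δ

/-- The envelope of the one-parameter family of curves `{x : G t x = 0}`: the points `x` that
satisfy `G t x = 0` and `∂G/∂t (t, x) = 0` for some value `t` of the parameter. -/
def envelope (G : ℝ → Plane → ℝ) : Set Plane :=
  {x | ∃ t, G t x = 0 ∧ HasDerivAt (fun s => G s x) 0 t}

/-- The curve of flotation `Π_δ(K)`: the envelope of the water lines `{x : ⟨dir θ, x⟩ = h θ}`,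
where for every `θ` the half-plane `{x : ⟨dir θ, x⟩ ≤ h θ}` cuts off from `K` the area `δ`.
(If `K` is a convex body and `0 < δ < Vol K`, there is exactly one such function `h`.) -/
def flotationCurve (K : Set Plane) (δ : ℝ) : Set Plane :=
  {x | ∃ h : ℝ → ℝ, (∀ θ, CutsOff K δ (dir θ) (h θ)) ∧
    x ∈ envelope (fun θ y => inner ℝ (dir θ) y - h θ)}

/-- The curve of buoyancy `Γ_δ(K)`: the set of centroids of the parts of area `δ` that
half-planes cut off from `K`. -/
def buoyancyCurve (K : Set Plane) (δ : ℝ) : Set Plane :=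
  {b | ∃ θ h : ℝ, CutsOff K δ (dir θ) h ∧ b = ⨍ x in K ∩ halfPlane (dir θ) h, x}

/-- Two sets are homothetic if a dilation (of non-zero ratio) about some point maps one to the
other. -/
def Homothetic (A B : Set Plane) : Prop :=
  ∃ (z : Plane) (r : ℝ), r ≠ 0 ∧ AffineMap.homothety z r '' A = B

/-- The boundary of `K` is a simple closed regular plane curve of class `C²`. -/
def HasC2Boundary (K : Set Plane) : Prop :=
  ∃ (γ : ℝ → Plane) (T : ℝ), 0 < T ∧ ContDiff ℝ 2 γ ∧ (∀ s, deriv γ s ≠ 0) ∧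
    Function.Periodic γ T ∧ InjOn γ (Ico 0 T) ∧ γ '' Ico 0 T = frontier K

/-- `K` is a (solid) ellipse: the image of the closed unit disc under an invertible affine map. -/
def IsEllipse (K : Set Plane) : Prop :=
  ∃ A : Plane ≃ᵃ[ℝ] Plane, A '' Metric.closedBall 0 1 = K

end Flotation

namespace Flotation

/-! Write $h(\theta,\delta)$ for the level of the water line, $\ell$ for the length of its chord,
$p$ for the midpoint of the chord and $b$ for the centroid of the part cut off. Differentiating area
and first moment gives $\partial_\theta h=\langle \mathrm{nor}\,\theta,p\rangle$ and
$\partial_\delta h=1/\ell$, so that $p$ runs through the curve of flotation, and $\partial_\theta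
b=-\frac{\ell^3}{12\delta}\,\mathrm{nor}\,\theta$, $\partial_\delta b=(p-b)/\delta$. Hence $b$ is a
strictly convex curve with normal $\mathrm{dir}\,\theta$.

Homothety is a relation between sets and has to be turned into one between parametrizations. An
envelope that runs on a strictly convex smooth curve is stationary wherever its line is not tangent
to that curve; it would then stay at one point through half a turn, which forces $\delta$ to be half
the area. For every other $\delta$ the water lines are tangents of a homothetic copy of $b$:
$h(\theta)=\langle \mathrm{dir}\,\theta, r\,b(\theta+\sigma)+w\rangle$ with $\sigma\in\{0,\pi\}$
(`envelope_rigidity`, `isTangential_of_homothetic`).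

For each $\sigma$ this is a closed condition on $\delta$. If the set in question were somewhere
dense, one of the two conditions would hold at each $\delta$ of a non-empty open set. Where one of
them holds on a neighbourhood, it may be differentiated in $\delta$: $u=1/\ell$ becomes a
combination of support functions of $b$ (`exists_inv_len_eq`) and solves a second order equation in
$\theta$. For $\sigma=\pi$ the equation contains the delay $\pi$; a maximum principle makes $u$
$\pi$-periodic (`ermakov_pi_periodic`), which reduces this case to $\sigma=0$
(`isTangential_zero_of_pi`). For $\sigma=0$ it is the Ermakov equation $u''+u=c^2/u^3$, whose
solutions come from uniform rotation along an ellipse, and the endpoints of the chords then trace an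
ellipse (`isEllipse_of_tangential`). -/

open Filter Topology

/-! ### The rotating orthonormal frame -/

/-- The unit vector `dir θ` turned by a right angle; it is the derivative of `dir` at `θ`. -/
noncomputable def nor (θ : ℝ) : Plane := !₂[-Real.sin θ, Real.cos θ]

/-- The point with coordinates `(a, y)` in the orthonormal frame `(dir θ, nor θ)`. -/
noncomputable def pt (θ a y : ℝ) : Plane := a • dir θ + y • nor θ

@[simp] lemma dir_zero_apply (θ : ℝ) : dir θ 0 = Real.cos θ := by simp [dir]
@[simp] lemma dir_one_apply (θ : ℝ) : dir θ 1 = Real.sin θ := by simp [dir]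
@[simp] lemma nor_zero_apply (θ : ℝ) : nor θ 0 = -Real.sin θ := by simp [nor]
@[simp] lemma nor_one_apply (θ : ℝ) : nor θ 1 = Real.cos θ := by simp [nor]
@[simp] lemma pt_zero_apply (θ a y : ℝ) : pt θ a y 0 = a * Real.cos θ - y * Real.sin θ := by
  simp [pt]; ring
@[simp] lemma pt_one_apply (θ a y : ℝ) : pt θ a y 1 = a * Real.sin θ + y * Real.cos θ := by
  simp [pt]

lemma plane_ext {x y : Plane} (h0 : x 0 = y 0) (h1 : x 1 = y 1) : x = y := by
  ext i; fin_cases i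
  · exact h0
  · exact h1

lemma inner_eq (x y : Plane) : inner ℝ x y = x 0 * y 0 + x 1 * y 1 := by
  simp [PiLp.inner_apply, Fin.sum_univ_two, mul_comm]

lemma norm_sq_eq (x : Plane) : ‖x‖ ^ 2 = x 0 ^ 2 + x 1 ^ 2 := by
  simp [EuclideanSpace.norm_sq_eq, Fin.sum_univ_two]

lemma dir_add_pi (θ : ℝ) : dir (θ + Real.pi) = -dir θ := by
  apply plane_ext <;> simp

lemma nor_add_pi (θ : ℝ) : nor (θ + Real.pi) = -nor θ := by
  apply plane_ext <;> simp

lemma dir_add_two_pi (θ : ℝ) : dir (θ + 2 * Real.pi) = dir θ := by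
  apply plane_ext <;> simp

lemma nor_add_two_pi (θ : ℝ) : nor (θ + 2 * Real.pi) = nor θ := by
  apply plane_ext <;> simp

lemma inner_dir_dir (θ φ : ℝ) : inner ℝ (dir θ) (dir φ) = Real.cos (φ - θ) := by
  rw [inner_eq, Real.cos_sub]; simp; ring

lemma inner_dir_nor (θ φ : ℝ) : inner ℝ (dir θ) (nor φ) = Real.sin (θ - φ) := by
  rw [inner_eq, Real.sin_sub]; simp; ring

lemma inner_nor_nor (θ φ : ℝ) : inner ℝ (nor θ) (nor φ) = Real.cos (φ - θ) := by
  rw [inner_eq, Real.cos_sub]; simp; ring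

lemma inner_nor_dir (θ φ : ℝ) : inner ℝ (nor θ) (dir φ) = Real.sin (φ - θ) := by
  rw [real_inner_comm, inner_dir_nor]

lemma norm_dir (θ : ℝ) : ‖dir θ‖ = 1 := by
  have h := norm_sq_eq (dir θ)
  simp only [dir_zero_apply, dir_one_apply, Real.cos_sq_add_sin_sq] at h
  have := norm_nonneg (dir θ)
  nlinarith

lemma hasDerivAt_plane {f : ℝ → Plane} {f' : Plane} {t : ℝ}
    (h0 : HasDerivAt (fun s => f s 0) (f' 0) t) (h1 : HasDerivAt (fun s => f s 1) (f' 1) t) :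
    HasDerivAt f f' t := by
  rw [← hasDerivWithinAt_univ, hasDerivWithinAt_iff_hasFDerivWithinAt, hasFDerivWithinAt_euclidean]
  intro i; fin_cases i
  · exact h0.hasFDerivAt.hasFDerivWithinAt.congr_fderiv (by ext; simp)
  · exact h1.hasFDerivAt.hasFDerivWithinAt.congr_fderiv (by ext; simp)

lemma hasDerivAt_dir (θ : ℝ) : HasDerivAt dir (nor θ) θ := by
  apply hasDerivAt_plane
  · simpa using Real.hasDerivAt_cos θ
  · simpa using Real.hasDerivAt_sin θ

lemma hasDerivAt_nor (θ : ℝ) : HasDerivAt nor (-dir θ) θ := by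
  apply hasDerivAt_plane
  · simpa using (Real.hasDerivAt_sin θ).fun_neg
  · simpa using Real.hasDerivAt_cos θ

lemma continuous_dir : Continuous dir :=
  continuous_iff_continuousAt.2 fun θ => (hasDerivAt_dir θ).continuousAt

lemma continuous_nor : Continuous nor :=
  continuous_iff_continuousAt.2 fun θ => (hasDerivAt_nor θ).continuousAt

lemma inner_dir_pt (θ φ a y : ℝ) :
    inner ℝ (dir θ) (pt φ a y) = a * Real.cos (θ - φ) + y * Real.sin (θ - φ) := by
  rw [pt, inner_add_right, inner_smul_right, inner_smul_right, inner_dir_dir, inner_dir_nor,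
    ← Real.cos_neg, neg_sub]

lemma inner_dir_pt_self (θ a y : ℝ) : inner ℝ (dir θ) (pt θ a y) = a := by
  simp [inner_dir_pt]

lemma pt_inner (θ : ℝ) (x : Plane) : pt θ (inner ℝ (dir θ) x) (inner ℝ (nor θ) x) = x := by
  have := Real.cos_sq_add_sin_sq θ
  apply plane_ext
  · simp [inner_eq]; linear_combination (x 0) * this
  · simp [inner_eq]; linear_combination (x 1) * this

lemma abs_le_norm_pt (θ a y : ℝ) : |y| ≤ ‖pt θ a y‖ := by
  refine abs_le_of_sq_le_sq ?_ (norm_nonneg _)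
  rw [norm_sq_eq]
  have := Real.cos_sq_add_sin_sq θ
  simp only [pt_zero_apply, pt_one_apply]
  nlinarith [sq_nonneg a]

lemma continuous_pt : Continuous fun p : ℝ × ℝ × ℝ => pt p.1 p.2.1 p.2.2 := by
  unfold pt
  have := continuous_dir
  have := continuous_nor
  fun_prop

/-- The coordinates in the frame `(dir θ, nor θ)`, as a linear isometry of the plane. -/
noncomputable def rotation (θ : ℝ) : Plane ≃ₗᵢ[ℝ] Plane where
  toFun v := pt θ (v 0) (v 1)
  invFun x := !₂[inner ℝ (dir θ) x, inner ℝ (nor θ) x]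
  map_add' v w := by apply plane_ext <;> simp <;> ring
  map_smul' c v := by apply plane_ext <;> simp <;> ring
  left_inv v := by
    apply plane_ext
    · simp [inner_dir_pt_self]
    · simp only [pt, inner_add_right, inner_smul_right, inner_nor_dir, inner_nor_nor]; simp
  right_inv x := by simpa using pt_inner θ x
  norm_map' v := by
    have h : ‖pt θ (v 0) (v 1)‖ ^ 2 = ‖v‖ ^ 2 := by
      rw [norm_sq_eq, norm_sq_eq]
      have := Real.cos_sq_add_sin_sq θ
      simp only [pt_zero_apply, pt_one_apply]
      linear_combination (v 0 ^ 2 + v 1 ^ 2) * this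
    exact (sq_eq_sq₀ (norm_nonneg _) (norm_nonneg _)).1 h

/-- The coordinates in the frame `(dir θ, nor θ)`, as a measurable equivalence. -/
noncomputable def frame (θ : ℝ) : ℝ × ℝ ≃ᵐ Plane :=
  (MeasurableEquiv.finTwoArrow.symm.trans (MeasurableEquiv.toLp 2 (Fin 2 → ℝ))).trans
    (rotation θ).toMeasurableEquiv

lemma frame_apply (θ : ℝ) (p : ℝ × ℝ) : frame θ p = pt θ p.1 p.2 := rfl

lemma measurePreserving_frame (θ : ℝ) : MeasurePreserving (frame θ) volume volume :=
  (((volume_preserving_finTwoArrow ℝ).symm _).trans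
    (EuclideanSpace.volume_preserving_symm_measurableEquiv_toLp (Fin 2)).symm).trans
      (rotation θ).measurePreserving

lemma volume_line (θ s : ℝ) : volume {x : Plane | inner ℝ (dir θ) x = s} = 0 := by
  rw [← (measurePreserving_frame θ).measure_preimage_equiv]
  have : (frame θ) ⁻¹' {x : Plane | inner ℝ (dir θ) x = s} = {s} ×ˢ univ := by
    ext p; simp [frame_apply, inner_dir_pt_self]
  rw [this, Measure.volume_eq_prod, Measure.prod_prod]
  simp

lemma isClosed_halfPlane (ξ : Plane) (h : ℝ) : IsClosed (halfPlane ξ h) :=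
  isClosed_le (by fun_prop) continuous_const

/-! ### Chords of a convex set -/

/-- The set of parameters of the points of `K` on the line `{x : ⟨dir θ, x⟩ = s}`. -/
def chord (K : Set Plane) (θ s : ℝ) : Set ℝ := {y | pt θ s y ∈ K}

lemma continuous_pt_snd (θ s : ℝ) : Continuous fun y => pt θ s y := by
  unfold pt; fun_prop

lemma continuous_pt_fst (θ y : ℝ) : Continuous fun s => pt θ s y := by
  unfold pt; fun_prop

lemma convex_chord {K : Set Plane} (hK : Convex ℝ K) (θ s : ℝ) : Convex ℝ (chord K θ s) := by
  intro y hy z hz a b ha hb hab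
  have := hK hy hz ha hb hab
  rw [chord, mem_ofPred_eq]
  convert! this using 1
  simp only [pt, smul_add, smul_smul, smul_eq_mul, add_smul]
  have h : s • dir θ = (a * s) • dir θ + (b * s) • dir θ := by
    rw [← add_smul, ← add_mul, hab, one_mul]
  rw [h]; abel

lemma isClosed_chord {K : Set Plane} (hK : IsClosed K) (θ s : ℝ) : IsClosed (chord K θ s) :=
  hK.preimage (continuous_pt_snd θ s)

lemma exists_chord_bound {K : Set Plane} (hK : IsCompact K) :
    ∃ B : ℝ, 0 < B ∧ ∀ θ s y, y ∈ chord K θ s → |y| ≤ B := by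
  obtain ⟨B, hB⟩ := hK.isBounded.exists_norm_le
  refine ⟨max B 1, by positivity, fun θ s y hy => ?_⟩
  exact (abs_le_norm_pt θ s y).trans ((hB _ hy).trans (le_max_left _ _))

lemma isCompact_chord {K : Set Plane} (hK : IsCompact K) (θ s : ℝ) : IsCompact (chord K θ s) := by
  obtain ⟨B, -, hB⟩ := exists_chord_bound hK
  exact (isCompact_Icc (a := -B) (b := B)).of_isClosed_subset (isClosed_chord hK.isClosed θ s)
    fun y hy => abs_le.1 (hB θ s y hy)

/-- Almost no point of a line that meets the interior of a convex set is a boundary point. -/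
lemma ae_mem_interior_or_compl {K : Set Plane} (hK : Convex ℝ K) {θ s y₀ : ℝ}
    (h0 : pt θ s y₀ ∈ interior K) :
    ∀ᵐ y : ℝ, pt θ s y ∈ interior K ∨ pt θ s y ∈ Kᶜ := by
  have hf := (convex_chord hK θ s).addHaar_frontier (μ := (volume : Measure ℝ))
  have h0' : y₀ ∈ interior (chord K θ s) := by
    refine mem_interior.2 ⟨(fun y => pt θ s y) ⁻¹' interior K, fun y (hy : pt θ s y ∈ interior K) =>
      (interior_subset hy : pt θ s y ∈ K),
      isOpen_interior.preimage (continuous_pt_snd θ s), h0⟩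
  filter_upwards [measure_eq_zero_iff_ae_notMem.1 hf] with y hy
  by_cases hyK : pt θ s y ∈ K
  · left
    have hyi : y ∈ interior (chord K θ s) := by
      by_contra hcon
      exact hy ⟨subset_closure hyK, hcon⟩
    obtain ⟨ε, hε, hball⟩ := Metric.isOpen_iff.1 isOpen_interior y hyi
    rcases eq_or_ne y y₀ with rfl | hne
    · exact h0
    have hd : 0 < |y - y₀| := abs_pos.2 (sub_ne_zero.2 hne)
    -- The length of `t * (y - y₀)` is `ε / 2`, so prolonging the segment from `y₀` beyond `y` by
    -- this amount stays in the chord; `y` then lies strictly between an interior point and a point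
    -- of `K`.
    set t := ε / (2 * |y - y₀|) with ht
    have htpos : 0 < t := by positivity
    have hz : y + t * (y - y₀) ∈ chord K θ s := by
      apply interior_subset
      apply hball
      rw [Metric.mem_ball, Real.dist_eq, add_sub_cancel_left, abs_mul, abs_of_pos htpos, ht]
      field_simp
      linarith
    apply hK.openSegment_interior_self_subset_interior h0 hz
    refine ⟨t / (1 + t), 1 / (1 + t), by positivity, by positivity, by field_simp; ring, ?_⟩
    apply plane_ext <;> simp <;> field_simp <;> ring
  · exact Or.inr hyK

/-! ### Differentiating integrals over the part cut off -/

section Derivative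

variable {E : Type*} [NormedAddCommGroup E] [NormedSpace ℝ E]

lemma norm_integral_Iic_sub_le {g : ℝ → E} (hg : Integrable g) {C : ℝ} (hC : ∀ a, ‖g a‖ ≤ C)
    (s t : ℝ) : ‖(∫ a in Iic s, g a) - ∫ a in Iic t, g a‖ ≤ C * |s - t| := by
  rw [intervalIntegral.integral_Iic_sub_Iic hg.integrableOn hg.integrableOn]
  exact intervalIntegral.norm_integral_le_of_norm_le_const fun a _ => hC a

lemma hasDerivAt_integral_Iic [CompleteSpace E] {g : ℝ → E} (hg : Integrable g) {s : ℝ}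
    (hs : ContinuousAt g s) :
    HasDerivAt (fun t => ∫ a in Iic t, g a) (g s) s := by
  have h : (fun t => ∫ a in Iic t, g a) =
      fun t => (∫ a in Iic s, g a) + ∫ a in s..t, g a := by
    ext t
    rw [← intervalIntegral.integral_Iic_sub_Iic hg.integrableOn hg.integrableOn]
    abel
  rw [h]
  refine HasDerivAt.const_add _ ?_
  exact intervalIntegral.integral_hasDerivAt_right (by simp)
    hg.aestronglyMeasurable.stronglyMeasurableAtFilter hs

/-- In the frame of a fixed angle `θ₀` a nearby half-plane is the region below the graph of an
affine function of `y`. Turning the line becomes a shear, and Fubini reduces the derivative to one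
on each parallel to `dir θ₀`. -/
lemma integral_cut_eq (θ₀ θ s : ℝ) (hc : 0 < Real.cos (θ - θ₀)) {K : Set Plane}
    (hK : MeasurableSet K) {f : Plane → E} (hf : IntegrableOn f K) :
    ∫ x in K ∩ halfPlane (dir θ) s, f x =
      ∫ y : ℝ, ∫ a in Iic (s / Real.cos (θ - θ₀) + (-Real.tan (θ - θ₀)) * y),
        K.indicator f (pt θ₀ a y) := by
  have hH := (isClosed_halfPlane (dir θ) s).measurableSet
  rw [inter_comm, ← Measure.restrict_restrict hH, ← integral_indicator hH,
    ← integral_indicator hK, ← (measurePreserving_frame θ₀).integral_comp',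
    Measure.volume_eq_prod, integral_prod_symm]
  · congr 1; ext y
    rw [← integral_indicator measurableSet_Iic]
    congr 1; ext a
    simp only [frame_apply]
    have : pt θ₀ a y ∈ halfPlane (dir θ) s ↔
        a ∈ Iic (s / Real.cos (θ - θ₀) + -Real.tan (θ - θ₀) * y) := by
      rw [halfPlane, mem_ofPred_eq, inner_dir_pt, mem_Iic, Real.tan_eq_sin_div_cos]
      rw [show s / Real.cos (θ - θ₀) + -(Real.sin (θ - θ₀) / Real.cos (θ - θ₀)) * y =
        (s - Real.sin (θ - θ₀) * y) / Real.cos (θ - θ₀) by field_simp; ring, le_div_iff₀ hc]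
      constructor <;> intro h <;> linarith
    by_cases h1 : pt θ₀ a y ∈ K <;> by_cases h2 : pt θ₀ a y ∈ halfPlane (dir θ) s
    · rw [indicator_of_mem h1, indicator_of_mem h2, indicator_of_mem (this.1 h2),
        indicator_of_mem h1]
    · rw [indicator_of_mem h1, indicator_of_notMem h2, indicator_of_notMem (mt this.2 h2)]
    · simp [indicator, h1]
    · simp [indicator, h1]
  · rw [← Measure.volume_eq_prod]
    refine ((measurePreserving_frame θ₀).integrable_comp_emb
      (g := K.indicator ((halfPlane (dir θ) s).indicator f)) (frame θ₀).measurableEmbedding).2 ?_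
    rw [integrable_indicator_iff hK]
    exact hf.indicator hH

lemma abs_le_norm_pt_fst (θ a y : ℝ) : |a| ≤ ‖pt θ a y‖ := by
  refine abs_le_of_sq_le_sq ?_ (norm_nonneg _)
  rw [norm_sq_eq]
  have := Real.cos_sq_add_sin_sq θ
  simp only [pt_zero_apply, pt_one_apply]
  nlinarith [sq_nonneg y]

lemma isCompact_setOf_pt_mem {K : Set Plane} (hK : IsCompact K) (θ y : ℝ) :
    IsCompact {a | pt θ a y ∈ K} := by
  obtain ⟨B, hB⟩ := hK.isBounded.exists_norm_le
  exact (isCompact_Icc (a := -B) (b := B)).of_isClosed_subset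
    (hK.isClosed.preimage (continuous_pt_fst θ y))
    fun a ha => abs_le.1 ((abs_le_norm_pt_fst θ a y).trans (hB _ ha))

/-- By the fundamental theorem of calculus the inner integral has derivative `f (pt θ s y)` times
that of its upper limit whenever the integrand is continuous there, which fails only for a null set
of `y`. Dominated convergence does the rest, with no smoothness of the boundary. -/
lemma hasFDerivAt_integral_shear [CompleteSpace E] {K : Set Plane} (hK : Convex ℝ K)
    (hc : IsCompact K) {f : Plane → E} (hf : Continuous f) {θ s y₀ : ℝ}
    (h0 : pt θ s y₀ ∈ interior K) :
    HasFDerivAt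
      (fun p : ℝ × ℝ => ∫ y : ℝ, ∫ a in Iic (p.1 + p.2 * y), K.indicator f (pt θ a y))
      ((ContinuousLinearMap.fst ℝ ℝ ℝ).smulRight (∫ y in chord K θ s, f (pt θ s y)) +
        (ContinuousLinearMap.snd ℝ ℝ ℝ).smulRight (∫ y in chord K θ s, y • f (pt θ s y)))
      (s, 0) := by
  obtain ⟨B, hB0, hB⟩ := exists_chord_bound hc
  obtain ⟨C, hC0, hC⟩ : ∃ C : ℝ, 0 ≤ C ∧ ∀ x ∈ K, ‖f x‖ ≤ C := by
    obtain ⟨C, hC⟩ := hc.exists_bound_of_continuousOn hf.continuousOn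
    exact ⟨|C|, abs_nonneg C, fun x hx => (hC x hx).trans (le_abs_self C)⟩
  have hCh : MeasurableSet (chord K θ s) := (isClosed_chord hc.isClosed θ s).measurableSet
  have hg : ∀ y, Integrable fun a => K.indicator f (pt θ a y) := fun y => by
    have : (fun a => K.indicator f (pt θ a y)) =
        {a | pt θ a y ∈ K}.indicator fun a => f (pt θ a y) := rfl
    rw [this, integrable_indicator_iff (isCompact_setOf_pt_mem hc θ y).measurableSet]
    exact (hf.comp (continuous_pt_fst θ y)).continuousOn.integrableOn_compact
      (isCompact_setOf_pt_mem hc θ y)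
  have hgC : ∀ y a, ‖K.indicator f (pt θ a y)‖ ≤ (Icc (-B) B).indicator (fun _ => C) y := by
    intro y a
    by_cases h : pt θ a y ∈ K
    · rw [indicator_of_mem h, indicator_of_mem (show y ∈ Icc (-B) B from abs_le.1 (hB θ a y h))]
      exact hC _ h
    · rw [indicator_of_notMem h, norm_zero]
      exact indicator_nonneg (fun _ _ => hC0) y
  have hg1 : (fun y => K.indicator f (pt θ s y)) =
      (chord K θ s).indicator fun y => f (pt θ s y) := rfl
  have hg2 : (fun y => y • K.indicator f (pt θ s y)) =
      (chord K θ s).indicator fun y => y • f (pt θ s y) := by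
    ext y; by_cases h : pt θ s y ∈ K
    · rw [indicator_of_mem h, indicator_of_mem (show y ∈ chord K θ s from h)]
    · rw [indicator_of_notMem h, indicator_of_notMem (show y ∉ chord K θ s from h), smul_zero]
  have hi1 : Integrable fun y => K.indicator f (pt θ s y) := by
    rw [hg1, integrable_indicator_iff hCh]
    exact (hf.comp (continuous_pt_snd θ s)).continuousOn.integrableOn_compact
      (isCompact_chord hc θ s)
  have hi2 : Integrable fun y => y • K.indicator f (pt θ s y) := by
    rw [hg2, integrable_indicator_iff hCh]
    exact (continuous_id.smul (hf.comp (continuous_pt_snd θ s))).continuousOn.integrableOn_compact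
      (isCompact_chord hc θ s)
  set L1 : E →L[ℝ] (ℝ × ℝ →L[ℝ] E) :=
    ContinuousLinearMap.smulRightL ℝ (ℝ × ℝ) E (ContinuousLinearMap.fst ℝ ℝ ℝ) with hL1
  set L2 : E →L[ℝ] (ℝ × ℝ →L[ℝ] E) :=
    ContinuousLinearMap.smulRightL ℝ (ℝ × ℝ) E (ContinuousLinearMap.snd ℝ ℝ ℝ) with hL2
  have hLi := L1.integrable_comp hi1
  have hLi2 := L2.integrable_comp hi2
  have hmeas : ∀ p : ℝ × ℝ, AEStronglyMeasurable
      fun y => ∫ a in Iic (p.1 + p.2 * y), K.indicator f (pt θ a y) := by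
    intro p
    have h1 : StronglyMeasurable fun q : ℝ × ℝ => K.indicator f (pt θ q.2 q.1) := by
      apply (hf.stronglyMeasurable.indicator hc.measurableSet).comp_measurable
      have : Continuous fun q : ℝ × ℝ => pt θ q.2 q.1 := by unfold pt; fun_prop
      exact this.measurable
    have h2 : MeasurableSet {q : ℝ × ℝ | q.2 ≤ p.1 + p.2 * q.1} :=
      (isClosed_le (by fun_prop) (by fun_prop)).measurableSet
    have h3 := StronglyMeasurable.integral_prod_right (ν := (volume : Measure ℝ))
      (f := fun y a => {q : ℝ × ℝ | q.2 ≤ p.1 + p.2 * q.1}.indicator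
        (fun q : ℝ × ℝ => K.indicator f (pt θ q.2 q.1)) (y, a)) (h1.indicator h2)
    refine h3.aestronglyMeasurable.congr (Eventually.of_forall fun y => ?_)
    simp only
    rw [← integral_indicator measurableSet_Iic]
    rfl
  -- The Lipschitz constant in `p` is `C * (1 + B)`: `C` bounds `f` on `K`, and `|y| ≤ B` on all
  -- chords.
  have key := hasFDerivAt_integral_of_dominated_loc_of_lip (μ := (volume : Measure ℝ)) (𝕜 := ℝ)
    (F := fun (p : ℝ × ℝ) y => ∫ a in Iic (p.1 + p.2 * y), K.indicator f (pt θ a y))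
    (F' := fun y => L1 (K.indicator f (pt θ s y)) + L2 (y • K.indicator f (pt θ s y)))
    (x₀ := (s, 0)) (s := univ) (bound := (Icc (-B) B).indicator fun _ => C * (1 + B))
    univ_mem (Eventually.of_forall hmeas) ?_ (hLi.add hLi2).aestronglyMeasurable ?_ ?_ ?_
  · convert! key.2 using 1
    rw [integral_add hLi hLi2, L1.integral_comp_comm hi1, L2.integral_comp_comm hi2, hg1, hg2,
      integral_indicator hCh, integral_indicator hCh]
    rfl
  · have h1 : Integrable fun q : ℝ × ℝ => K.indicator f (pt θ q.1 q.2) := by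
      refine ((measurePreserving_frame θ).integrable_comp_emb
        (g := K.indicator f) (frame θ).measurableEmbedding).2 ?_
      rw [integrable_indicator_iff hc.measurableSet]
      exact hf.continuousOn.integrableOn_compact hc
    have h2 : Integrable ({q : ℝ × ℝ | q.1 ≤ s}.indicator
        fun q : ℝ × ℝ => K.indicator f (pt θ q.1 q.2)) :=
      h1.indicator (isClosed_le (by fun_prop) (by fun_prop)).measurableSet
    rw [Measure.volume_eq_prod] at h2
    refine h2.integral_prod_right.congr (Eventually.of_forall fun y => ?_)
    simp only [zero_mul, add_zero]
    rw [← integral_indicator measurableSet_Iic]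
    rfl
  · refine Eventually.of_forall fun y => LipschitzOnWith.of_dist_le_mul fun p _ q _ => ?_
    rw [dist_eq_norm, dist_eq_norm]
    refine (norm_integral_Iic_sub_le (hg y) (hgC y) _ _).trans ?_
    by_cases hy : y ∈ Icc (-B) B
    · rw [indicator_of_mem hy, indicator_of_mem hy]
      have h1 : |p.1 - q.1| ≤ ‖p - q‖ := norm_fst_le (p - q)
      have h2 : |p.2 - q.2| ≤ ‖p - q‖ := norm_snd_le (p - q)
      have h3 : |p.1 + p.2 * y - (q.1 + q.2 * y)| ≤ (1 + B) * ‖p - q‖ := by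
        rw [show p.1 + p.2 * y - (q.1 + q.2 * y) = (p.1 - q.1) + (p.2 - q.2) * y by ring]
        refine (abs_add_le _ _).trans ?_
        rw [abs_mul]
        have := mul_le_mul h2 (abs_le.2 hy) (abs_nonneg y) (norm_nonneg (p - q))
        linarith
      rw [Real.coe_nnabs, abs_of_nonneg (show 0 ≤ C * (1 + B) by positivity), mul_assoc]
      exact mul_le_mul_of_nonneg_left h3 hC0
    · rw [indicator_of_notMem hy, zero_mul]
      positivity
  · rw [integrable_indicator_iff measurableSet_Icc]
    exact continuous_const.continuousOn.integrableOn_compact isCompact_Icc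
  · filter_upwards [ae_mem_interior_or_compl hK h0] with y hy
    have hcont : ContinuousAt (fun a => K.indicator f (pt θ a y)) s := by
      rcases hy with hy | hy
      · have : (fun a => f (pt θ a y)) =ᶠ[𝓝 s] fun a => K.indicator f (pt θ a y) := by
          filter_upwards [(isOpen_interior.preimage (continuous_pt_fst θ y)).mem_nhds hy] with a ha
          exact (indicator_of_mem (interior_subset ha) _).symm
        exact ((hf.comp (continuous_pt_fst θ y)).continuousAt).congr this
      · have : (fun _ => (0 : E)) =ᶠ[𝓝 s] fun a => K.indicator f (pt θ a y) := by
          filter_upwards [(hc.isClosed.isOpen_compl.preimage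
            (continuous_pt_fst θ y)).mem_nhds hy] with a ha
          exact (indicator_of_notMem ha _).symm
        exact continuousAt_const.congr this
    have hd := hasDerivAt_integral_Iic (hg y) hcont
    have hl : HasFDerivAt (fun p : ℝ × ℝ => p.1 + p.2 * y)
        (ContinuousLinearMap.fst ℝ ℝ ℝ + y • ContinuousLinearMap.snd ℝ ℝ ℝ) (s, 0) :=
      hasFDerivAt_fst.add (hasFDerivAt_snd.mul_const y)
    have hd' : HasDerivAt (fun t => ∫ a in Iic t, K.indicator f (pt θ a y))
        (K.indicator f (pt θ s y)) ((fun p : ℝ × ℝ => p.1 + p.2 * y) (s, 0)) := by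
      simpa using hd
    refine (hd'.hasFDerivAt.comp (s, 0) hl).congr_fderiv ?_
    ext <;> simp [L1, L2]

/-- The derivative of the integral of a function over the part of a convex body in a half-plane,
with respect to the direction and the level of the half-plane. -/
theorem hasFDerivAt_integral_cut [CompleteSpace E] {K : Set Plane} (hK : Convex ℝ K)
    (hc : IsCompact K) {f : Plane → E} (hf : Continuous f) {θ s y₀ : ℝ}
    (h0 : pt θ s y₀ ∈ interior K) :
    HasFDerivAt (fun p : ℝ × ℝ => ∫ x in K ∩ halfPlane (dir p.1) p.2, f x)
      ((ContinuousLinearMap.snd ℝ ℝ ℝ).smulRight (∫ y in chord K θ s, f (pt θ s y)) -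
        (ContinuousLinearMap.fst ℝ ℝ ℝ).smulRight (∫ y in chord K θ s, y • f (pt θ s y)))
      (θ, s) := by
  have hsh := hasFDerivAt_integral_shear hK hc hf h0
  have hcos : HasDerivAt (fun t => Real.cos (t - θ)) 0 θ := by
    simpa using ((hasDerivAt_id θ).sub_const θ).cos
  have htan : HasDerivAt (fun t => -Real.tan (t - θ)) (-1) θ := by
    have h := (Real.hasDerivAt_tan (x := id θ - θ) (by simp)).comp θ
      (h := fun t => id t - θ) ((hasDerivAt_id θ).sub_const θ)
    simpa using h.fun_neg
  have h1 : HasFDerivAt (fun p : ℝ × ℝ => p.2 / Real.cos (p.1 - θ))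
      (ContinuousLinearMap.snd ℝ ℝ ℝ) (θ, s) := by
    have hinv : HasDerivAt (fun t => (Real.cos (t - θ))⁻¹) 0 θ := by
      simpa using hcos.fun_inv (by simp)
    have hinv' : HasFDerivAt (fun p : ℝ × ℝ => (Real.cos (p.1 - θ))⁻¹)
        ((0 : ℝ) • ContinuousLinearMap.fst ℝ ℝ ℝ) (θ, s) :=
      HasDerivAt.comp_hasFDerivAt (h₂ := fun t => (Real.cos (t - θ))⁻¹) (θ, s) hinv
        hasFDerivAt_fst
    have := hasFDerivAt_snd.mul hinv'
    simp only [div_eq_mul_inv]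
    refine this.congr_fderiv ?_
    ext <;> simp
  have h2 : HasFDerivAt (fun p : ℝ × ℝ => -Real.tan (p.1 - θ))
      (-ContinuousLinearMap.fst ℝ ℝ ℝ) (θ, s) := by
    have : HasFDerivAt (fun p : ℝ × ℝ => -Real.tan (p.1 - θ))
        ((-1 : ℝ) • ContinuousLinearMap.fst ℝ ℝ ℝ) (θ, s) :=
      HasDerivAt.comp_hasFDerivAt (h₂ := fun t => -Real.tan (t - θ)) (θ, s) htan hasFDerivAt_fst
    refine this.congr_fderiv ?_
    ext <;> simp
  have h12 := h1.prodMk h2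
  have hval : ((fun p : ℝ × ℝ => (p.2 / Real.cos (p.1 - θ), -Real.tan (p.1 - θ))) (θ, s)) =
      (s, 0) := by simp
  rw [← hval] at hsh
  have hcomp := (hsh.comp (θ, s) h12).congr_of_eventuallyEq
    (f₁ := fun p : ℝ × ℝ => ∫ x in K ∩ halfPlane (dir p.1) p.2, f x) ?_
  · refine hcomp.congr_fderiv ?_
    ext <;> simp
  · have hopen : IsOpen {p : ℝ × ℝ | 0 < Real.cos (p.1 - θ)} :=
      isOpen_lt continuous_const (by fun_prop)
    filter_upwards [hopen.mem_nhds (show (θ, s) ∈ {p : ℝ × ℝ | 0 < Real.cos (p.1 - θ)} by simp)]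
      with p hp
    exact integral_cut_eq θ p.1 p.2 hp hc.measurableSet (hf.continuousOn.integrableOn_compact hc)

end Derivative

/-! ### The area cut off and the level of the water line -/

/-- The area that the half-plane `{x : ⟨dir θ, x⟩ ≤ s}` cuts off from `K`. -/
noncomputable def area (K : Set Plane) (θ s : ℝ) : ℝ := volume.real (K ∩ halfPlane (dir θ) s)

lemma area_eq_integral (K : Set Plane) (θ s : ℝ) :
    area K θ s = ∫ _ in K ∩ halfPlane (dir θ) s, (1 : ℝ) := by
  simp [area]

/-- Off the limiting line, which is a null set, the indicator of the half-plane is locally constant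
in the parameters, so dominated convergence applies. -/
lemma continuous_area {K : Set Plane} (hc : IsCompact K) :
    Continuous fun p : ℝ × ℝ => area K p.1 p.2 := by
  have h1 : (fun p : ℝ × ℝ => area K p.1 p.2) =
      fun p : ℝ × ℝ => ∫ x in K, (halfPlane (dir p.1) p.2).indicator (fun _ => (1 : ℝ)) x := by
    ext p
    rw [setIntegral_indicator (isClosed_halfPlane _ _).measurableSet, area_eq_integral]
  rw [h1, continuous_iff_continuousAt]
  rintro ⟨θ, s⟩
  refine continuousAt_of_dominated (bound := fun _ => 1) (Eventually.of_forall fun p => ?_)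
    (Eventually.of_forall fun p => Eventually.of_forall fun x => ?_) ?_ ?_
  · exact (aestronglyMeasurable_const).indicator (isClosed_halfPlane _ _).measurableSet
  · refine (norm_indicator_le_norm_self _ _).trans (by simp)
  · exact continuous_const.continuousOn.integrableOn_compact hc
  · filter_upwards [ae_restrict_of_ae (measure_eq_zero_iff_ae_notMem.1 (volume_line θ s))] with x hx
    have hcont : Continuous fun p : ℝ × ℝ => inner ℝ (dir p.1) x :=
      (continuous_dir.comp continuous_fst).inner continuous_const
    rcases lt_or_gt_of_ne hx with h | h
    · have : (fun _ => (1 : ℝ)) =ᶠ[𝓝 (θ, s)]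
          fun p : ℝ × ℝ => (halfPlane (dir p.1) p.2).indicator (fun _ => (1 : ℝ)) x := by
        filter_upwards [(isOpen_lt hcont continuous_snd).mem_nhds h] with p hp
        have hx' : x ∈ halfPlane (dir p.1) p.2 := le_of_lt (show inner ℝ (dir p.1) x < p.2 from hp)
        exact (indicator_of_mem hx' fun _ => (1 : ℝ)).symm
      exact continuousAt_const.congr this
    · have : (fun _ => (0 : ℝ)) =ᶠ[𝓝 (θ, s)]
          fun p : ℝ × ℝ => (halfPlane (dir p.1) p.2).indicator (fun _ => (1 : ℝ)) x := by
        filter_upwards [(isOpen_lt continuous_snd hcont).mem_nhds h] with p hp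
        have hx' : x ∉ halfPlane (dir p.1) p.2 :=
          not_le_of_gt (show p.2 < inner ℝ (dir p.1) x from hp)
        exact (indicator_of_notMem hx' fun _ => (1 : ℝ)).symm
      exact continuousAt_const.congr this

lemma area_mono {K : Set Plane} (hc : IsCompact K) (θ : ℝ) : Monotone (area K θ) := by
  intro s t hst
  exact measureReal_mono (inter_subset_inter_right _ fun x hx => le_trans (b := s) hx hst)
    (measure_ne_top_of_subset inter_subset_left hc.measure_ne_top)

lemma continuous_area_right {K : Set Plane} (hc : IsCompact K) (θ : ℝ) :
    Continuous (area K θ) := by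
  have h := (continuous_area hc).comp (continuous_const (y := θ).prodMk continuous_id)
  simp only [Function.comp_def, id] at h
  exact h

lemma exists_area_eq {K : Set Plane} (hc : IsCompact K) (θ : ℝ) {δ : ℝ}
    (hδ : δ ∈ Ioo 0 (volume.real K)) : ∃ s, area K θ s = δ := by
  obtain ⟨B, hB⟩ := hc.isBounded.exists_norm_le
  have hin : ∀ x ∈ K, |inner ℝ (dir θ) x| ≤ B := fun x hx =>
    (abs_real_inner_le_norm _ _).trans (by rw [norm_dir, one_mul]; exact hB x hx)
  have h0 : area K θ (-B - 1) = 0 := by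
    have hemp : K ∩ halfPlane (dir θ) (-B - 1) = ∅ := by
      refine eq_empty_of_forall_notMem fun x hx => ?_
      have h1 := (abs_le.1 (hin x hx.1)).1
      have h2 : inner ℝ (dir θ) x ≤ -B - 1 := hx.2
      linarith
    rw [area, hemp, measureReal_empty]
  have h1 : area K θ B = volume.real K := by
    have hsub : K ⊆ halfPlane (dir θ) B := fun x hx => by
      have h : inner ℝ (dir θ) x ≤ B := (abs_le.1 (hin x hx)).2
      exact h
    rw [area, inter_eq_left.2 hsub]
  have hcont := continuous_area_right hc θ
  have hle : -B - 1 ≤ B := by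
    by_contra h
    have := area_mono hc θ (le_of_not_ge h)
    rw [h0, h1] at this
    linarith [hδ.1, hδ.2]
  have hmem : δ ∈ Icc (area K θ (-B - 1)) (area K θ B) := by
    rw [h0, h1]; exact ⟨hδ.1.le, hδ.2.le⟩
  exact (intermediate_value_Icc hle hcont.continuousOn hmem).imp fun s hs => hs.2

/-- A line that cuts a convex body into two parts of positive area meets its interior. -/
lemma exists_pt_mem_interior {K : Set Plane} (hK : Convex ℝ K) (hc : IsCompact K) {θ s : ℝ}
    (hδ : area K θ s ∈ Ioo 0 (volume.real K)) : ∃ y, pt θ s y ∈ interior K := by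
  have hpos : 0 < volume.real K := hδ.1.trans hδ.2
  have hvi : volume (frontier K) = 0 := hK.addHaar_frontier volume
  have hdiff : volume (K \ interior K) = 0 := by
    rw [← hc.isClosed.frontier_eq]; exact hvi
  have hae : ∀ᵐ x ∂(volume : Measure Plane), x ∈ K → x ∈ interior K := by
    filter_upwards [measure_eq_zero_iff_ae_notMem.1 hdiff] with x hx hxK
    by_contra h; exact hx ⟨hxK, h⟩
  have hlt : ∃ x ∈ interior K, inner ℝ (dir θ) x ≤ s := by
    by_contra! hcon
    have : volume (K ∩ halfPlane (dir θ) s) = 0 := by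
      rw [measure_eq_zero_iff_ae_notMem]
      filter_upwards [hae] with x hx h
      exact absurd h.2 (not_le_of_gt (hcon x (hx h.1)))
    exact hδ.1.ne' (by simp [area, measureReal_def, this])
  have hgt : ∃ x ∈ interior K, s ≤ inner ℝ (dir θ) x := by
    by_contra! hcon
    have : volume (K ∩ halfPlane (dir θ) s) = volume K := by
      apply measure_congr
      filter_upwards [hae] with x hx
      exact propext ⟨fun h => h.1, fun h => ⟨h, (hcon x (hx h)).le⟩⟩
    exact hδ.2.ne (by simp [area, measureReal_def, this])
  obtain ⟨x, hx, hxs⟩ := hlt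
  obtain ⟨z, hz, hzs⟩ := hgt
  obtain ⟨w, hw, hws⟩ := hK.interior.isPreconnected.intermediate_value hx hz
    (f := fun x => inner ℝ (dir θ) x) (by fun_prop) ⟨hxs, hzs⟩
  refine ⟨inner ℝ (nor θ) w, ?_⟩
  have := pt_inner θ w
  simp only at hws
  rw [hws] at this
  rwa [this]

lemma area_lt_area {K : Set Plane} (hc : IsCompact K) {θ s t y : ℝ}
    (hy : pt θ s y ∈ interior K) (hst : s < t) : area K θ s < area K θ t := by
  have hfin : volume (K ∩ halfPlane (dir θ) t) ≠ ⊤ :=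
    measure_ne_top_of_subset inter_subset_left hc.measure_ne_top
  set U := interior K ∩ {x | s < inner ℝ (dir θ) x ∧ inner ℝ (dir θ) x < t} with hU
  have hin : Continuous fun x : Plane => inner ℝ (dir θ) x := by fun_prop
  have hUo : IsOpen U := isOpen_interior.inter
    ((isOpen_lt continuous_const hin).inter (isOpen_lt hin continuous_const))
  have hUne : U.Nonempty := by
    have h1 : ∀ᶠ a in 𝓝[>] s, pt θ a y ∈ interior K := nhdsWithin_le_nhds
      ((isOpen_interior.preimage (continuous_pt_fst θ y)).mem_nhds hy)
    have h2 : ∀ᶠ a in 𝓝[>] s, a ∈ Ioo s t := Ioo_mem_nhdsGT hst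
    obtain ⟨a, ha1, ha2⟩ := (h1.and h2).exists
    exact ⟨pt θ a y, ha1, by simpa [inner_dir_pt_self] using ha2.1,
      by simpa [inner_dir_pt_self] using ha2.2⟩
  have hUpos : 0 < volume.real U := by
    refine ENNReal.toReal_pos (hUo.measure_pos volume hUne).ne' ?_
    exact measure_ne_top_of_subset (inter_subset_left.trans interior_subset) hc.measure_ne_top
  have hdisj : Disjoint (K ∩ halfPlane (dir θ) s) U := by
    rw [Set.disjoint_left]
    intro x hx hxU
    exact absurd hx.2 (not_le_of_gt hxU.2.1)
  have hun : volume.real ((K ∩ halfPlane (dir θ) s) ∪ U) =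
      volume.real (K ∩ halfPlane (dir θ) s) + volume.real U :=
    measureReal_union hdisj hUo.measurableSet
      (measure_ne_top_of_subset inter_subset_left hc.measure_ne_top)
      (measure_ne_top_of_subset (inter_subset_left.trans interior_subset) hc.measure_ne_top)
  have hsub : (K ∩ halfPlane (dir θ) s) ∪ U ⊆ K ∩ halfPlane (dir θ) t := by
    rintro x (hx | hx)
    · exact ⟨hx.1, le_trans (b := s) hx.2 hst.le⟩
    · exact ⟨interior_subset hx.1, hx.2.2.le⟩
  have := measureReal_mono hsub hfin
  rw [hun] at this
  unfold area
  linarith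

/-- The level of the line with normal `dir θ` that cuts off the area `δ` from `K`. -/
noncomputable def level (K : Set Plane) (δ θ : ℝ) : ℝ :=
  Classical.epsilon fun s => area K θ s = δ

section Level

variable {K : Set Plane} (hK : Convex ℝ K) (hc : IsCompact K) {δ : ℝ}
  (hδ : δ ∈ Ioo 0 (volume.real K)) (θ : ℝ)

include hc hδ

lemma area_level : area K θ (level K δ θ) = δ :=
  Classical.epsilon_spec (exists_area_eq hc θ hδ)

include hK

lemma exists_pt_level_mem_interior : ∃ y, pt θ (level K δ θ) y ∈ interior K :=
  exists_pt_mem_interior hK hc (by rwa [area_level hc hδ θ])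

lemma area_eq_iff {s : ℝ} : area K θ s = δ ↔ s = level K δ θ := by
  refine ⟨fun h => ?_, fun h => h ▸ area_level hc hδ θ⟩
  have hl := area_level hc hδ θ
  rcases lt_trichotomy s (level K δ θ) with hs | hs | hs
  · obtain ⟨y, hy⟩ := exists_pt_mem_interior hK hc (h.symm ▸ hδ)
    exact absurd (area_lt_area hc hy hs) (by rw [h, hl]; exact lt_irrefl _)
  · exact hs
  · obtain ⟨y, hy⟩ := exists_pt_level_mem_interior hK hc hδ θ
    exact absurd (area_lt_area hc hy hs) (by rw [h, hl]; exact lt_irrefl _)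

lemma cutsOff_iff {s : ℝ} : CutsOff K δ (dir θ) s ↔ s = level K δ θ := by
  rw [← area_eq_iff hK hc hδ θ, CutsOff, area, measureReal_def]
  have hfin : volume (K ∩ halfPlane (dir θ) s) ≠ ⊤ :=
    measure_ne_top_of_subset inter_subset_left hc.measure_ne_top
  exact ⟨fun h => by rw [h, ENNReal.toReal_ofReal hδ.1.le],
    fun h => by rw [← h, ENNReal.ofReal_toReal hfin]⟩

/-- Strict monotonicity of the area in the level at `(θ, δ)` traps the nearby levels: a strict
inequality between `δ` and the area at a fixed level `a` persists for nearby parameters. -/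
lemma continuousAt_level : ContinuousAt (fun p : ℝ × ℝ => level K p.2 p.1) (θ, δ) := by
  have hev : ∀ᶠ p : ℝ × ℝ in 𝓝 (θ, δ), p.2 ∈ Ioo 0 (volume.real K) :=
    continuous_snd.continuousAt.eventually_mem (isOpen_Ioo.mem_nhds hδ)
  have hl := area_level hc hδ θ
  have hcont : ∀ s, Continuous fun p : ℝ × ℝ => area K p.1 s := fun s =>
    (continuous_area hc).comp (continuous_fst.prodMk continuous_const)
  rw [ContinuousAt, tendsto_order]
  constructor
  · intro a (ha : a < level K δ θ)
    have hlt : area K θ a < δ := lt_of_le_of_ne (hl ▸ area_mono hc θ ha.le)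
      fun h => ha.ne ((area_eq_iff hK hc hδ θ).1 h)
    filter_upwards [hev, (isOpen_lt (hcont a) continuous_snd).mem_nhds hlt] with p hp1 hp2
    by_contra hcon
    have := area_mono hc p.1 (not_lt.1 hcon)
    rw [area_level hc hp1] at this
    exact absurd hp2 (not_lt_of_ge this)
  · intro a (ha : level K δ θ < a)
    have hlt : δ < area K θ a := lt_of_le_of_ne (hl ▸ area_mono hc θ ha.le)
      fun h => ha.ne' ((area_eq_iff hK hc hδ θ).1 h.symm)
    filter_upwards [hev, (isOpen_lt continuous_snd (hcont a)).mem_nhds hlt] with p hp1 hp2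
    by_contra hcon
    have := area_mono hc p.1 (not_lt.1 hcon)
    rw [area_level hc hp1] at this
    exact absurd hp2 (not_lt_of_ge this)

end Level

/-! ### Integrals over chords -/

section Chord

variable {K : Set Plane} (hK : Convex ℝ K) (hc : IsCompact K) {θ s y₀ : ℝ}

include hK hc

lemma exists_chord_eq_Icc (h0 : pt θ s y₀ ∈ interior K) :
    ∃ a b, a < b ∧ chord K θ s = Icc a b := by
  have hcomp := isCompact_chord hc θ s
  have hconv := convex_chord hK θ s
  have hne : (chord K θ s).Nonempty := ⟨y₀, (interior_subset h0 : pt θ s y₀ ∈ K)⟩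
  have heq : chord K θ s = Icc (sInf (chord K θ s)) (sSup (chord K θ s)) := by
    apply Subset.antisymm
    · exact fun y hy => ⟨csInf_le hcomp.bddBelow hy, le_csSup hcomp.bddAbove hy⟩
    · exact hconv.ordConnected.out (hcomp.sInf_mem hne) (hcomp.sSup_mem hne)
  refine ⟨_, _, ?_, heq⟩
  obtain ⟨ε, hε, hb⟩ := Metric.isOpen_iff.1
    (isOpen_interior.preimage (continuous_pt_snd θ s)) y₀ h0
  have hy : y₀ + ε / 2 ∈ chord K θ s := by
    have : y₀ + ε / 2 ∈ (fun y => pt θ s y) ⁻¹' interior K := by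
      apply hb
      rw [Metric.mem_ball, Real.dist_eq, add_sub_cancel_left, abs_of_pos (by linarith)]
      linarith
    exact (interior_subset this : pt θ s (y₀ + ε / 2) ∈ K)
  have hy0 : y₀ ∈ chord K θ s := (interior_subset h0 : pt θ s y₀ ∈ K)
  have h1 := csInf_le hcomp.bddBelow hy0
  have h2 := le_csSup hcomp.bddAbove hy
  linarith

lemma continuousAt_integral_chord (h0 : pt θ s y₀ ∈ interior K) {g : ℝ → ℝ} (hg : Continuous g) :
    ContinuousAt (fun p : ℝ × ℝ => ∫ y in chord K p.1 p.2, g y) (θ, s) := by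
  have hme : ∀ p : ℝ × ℝ, MeasurableSet (chord K p.1 p.2) := fun p =>
    (isClosed_chord hc.isClosed p.1 p.2).measurableSet
  obtain ⟨B, hB0, hB⟩ := exists_chord_bound hc
  simp only [fun p : ℝ × ℝ => (integral_indicator (f := g) (μ := volume) (hme p)).symm]
  refine continuousAt_of_dominated (bound := (Icc (-B) B).indicator fun y => ‖g y‖)
    (Eventually.of_forall fun p => ?_)
    (Eventually.of_forall fun p => Eventually.of_forall fun y => ?_) ?_ ?_
  · exact hg.aestronglyMeasurable.indicator (hme p)
  · rw [norm_indicator_eq_indicator_norm]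
    refine indicator_le_indicator_of_subset (fun y hy => ?_) (fun _ => norm_nonneg _) y
    exact abs_le.1 (hB _ _ y hy)
  · rw [integrable_indicator_iff measurableSet_Icc]
    exact hg.norm.continuousOn.integrableOn_compact isCompact_Icc
  · filter_upwards [ae_mem_interior_or_compl hK h0] with y hy
    have hcont : Continuous fun p : ℝ × ℝ => pt p.1 p.2 y :=
      continuous_pt.comp (continuous_fst.prodMk (continuous_snd.prodMk continuous_const))
    rcases hy with hy | hy
    · have : (fun _ => g y) =ᶠ[𝓝 (θ, s)] fun p : ℝ × ℝ => (chord K p.1 p.2).indicator g y := by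
        filter_upwards [(isOpen_interior.preimage hcont).mem_nhds hy] with p hp
        have hp' : y ∈ chord K p.1 p.2 := (interior_subset hp : pt p.1 p.2 y ∈ K)
        exact (indicator_of_mem hp' g).symm
      exact continuousAt_const.congr this
    · have : (fun _ => (0 : ℝ)) =ᶠ[𝓝 (θ, s)]
          fun p : ℝ × ℝ => (chord K p.1 p.2).indicator g y := by
        filter_upwards [(hc.isClosed.isOpen_compl.preimage hcont).mem_nhds hy] with p hp
        have hp' : y ∉ chord K p.1 p.2 := hp
        exact (indicator_of_notMem hp' g).symm
      exact continuousAt_const.congr this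

end Chord

lemma setIntegral_Icc_affine {a b : ℝ} (hab : a ≤ b) (v w : Plane) :
    ∫ y in Icc a b, (v + y • w) = (b - a) • v + ((b ^ 2 - a ^ 2) / 2) • w := by
  rw [integral_Icc_eq_integral_Ioc, ← intervalIntegral.integral_of_le hab,
    intervalIntegral.integral_add (by simp)
      ((by fun_prop : Continuous fun y : ℝ => y • w).intervalIntegrable _ _),
    intervalIntegral.integral_const, intervalIntegral.integral_smul_const, integral_id]

lemma setIntegral_Icc_smul_affine {a b : ℝ} (hab : a ≤ b) (v w : Plane) :
    ∫ y in Icc a b, y • (v + y • w) =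
      ((b ^ 2 - a ^ 2) / 2) • v + ((b ^ 3 - a ^ 3) / 3) • w := by
  simp only [smul_add, smul_smul, ← pow_two]
  rw [integral_Icc_eq_integral_Ioc, ← intervalIntegral.integral_of_le hab,
    intervalIntegral.integral_add
      ((by fun_prop : Continuous fun y : ℝ => y • v).intervalIntegrable _ _)
      ((by fun_prop : Continuous fun y : ℝ => y ^ 2 • w).intervalIntegrable _ _),
    intervalIntegral.integral_smul_const, intervalIntegral.integral_smul_const, integral_id,
    integral_pow]
  norm_num

lemma setIntegral_Icc_id {a b : ℝ} (hab : a ≤ b) :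
    ∫ y in Icc a b, y = (b ^ 2 - a ^ 2) / 2 := by
  rw [integral_Icc_eq_integral_Ioc, ← intervalIntegral.integral_of_le hab, integral_id]

/-! ### Variation of the level and of the centroid -/

/-- The length of the chord that cuts off the area `δ`. -/
noncomputable def len (K : Set Plane) (δ θ : ℝ) : ℝ := ∫ _ in chord K θ (level K δ θ), (1 : ℝ)

/-- The coordinate of the midpoint of the chord that cuts off the area `δ`. -/
noncomputable def mid (K : Set Plane) (δ θ : ℝ) : ℝ :=
  (∫ y in chord K θ (level K δ θ), y) / len K δ θ

/-- The centroid of the part of area `δ` that a half-plane with normal `dir θ` cuts off. -/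
noncomputable def centroid (K : Set Plane) (δ θ : ℝ) : Plane :=
  δ⁻¹ • ∫ x in K ∩ halfPlane (dir θ) (level K δ θ), x

lemma average_eq_centroid {K : Set Plane} (hc : IsCompact K) {δ : ℝ}
    (hδ : δ ∈ Ioo 0 (volume.real K)) (θ : ℝ) :
    ⨍ x in K ∩ halfPlane (dir θ) (level K δ θ), x = centroid K δ θ := by
  rw [setAverage_eq, centroid]
  congr 2
  exact area_level hc hδ θ

section Level

variable {K : Set Plane} (hK : Convex ℝ K) (hc : IsCompact K) {δ : ℝ}
  (hδ : δ ∈ Ioo 0 (volume.real K)) (θ : ℝ)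

include hK hc hδ

lemma chord_level_eq : 0 < len K δ θ ∧ chord K θ (level K δ θ) =
    Icc (mid K δ θ - len K δ θ / 2) (mid K δ θ + len K δ θ / 2) := by
  obtain ⟨y₀, h0⟩ := exists_pt_level_mem_interior hK hc hδ θ
  obtain ⟨a, b, hab, h⟩ := exists_chord_eq_Icc hK hc h0
  have hl : len K δ θ = b - a := by
    rw [len, h]; simp [hab.le]
  have hm : mid K δ θ = (a + b) / 2 := by
    rw [mid, hl, h, setIntegral_Icc_id hab.le]
    field_simp [sub_ne_zero.2 hab.ne']
    ring
  refine ⟨by rw [hl]; linarith, ?_⟩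
  rw [h, hl, hm]
  congr 1 <;> ring

lemma len_pos : 0 < len K δ θ := (chord_level_eq hK hc hδ θ).1

lemma integral_chord_pt :
    ∫ y in chord K θ (level K δ θ), pt θ (level K δ θ) y =
      len K δ θ • pt θ (level K δ θ) (mid K δ θ) := by
  obtain ⟨hpos, h⟩ := chord_level_eq hK hc hδ θ
  rw [h]
  simp only [pt]
  rw [setIntegral_Icc_affine (by linarith)]
  simp only [smul_add, smul_smul]
  congr 2 <;> ring

lemma integral_chord_smul_pt :
    ∫ y in chord K θ (level K δ θ), y • pt θ (level K δ θ) y =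
      (len K δ θ * mid K δ θ) • pt θ (level K δ θ) (mid K δ θ) +
        (len K δ θ ^ 3 / 12) • nor θ := by
  obtain ⟨hpos, h⟩ := chord_level_eq hK hc hδ θ
  rw [h]
  simp only [pt]
  rw [setIntegral_Icc_smul_affine (by linarith)]
  simp only [smul_add, smul_smul, add_assoc, ← add_smul]
  congr 2 <;> ring

/-- The endpoints of the chords are boundary points. -/
lemma pt_mem_frontier {y : ℝ}
    (hy : y = mid K δ θ - len K δ θ / 2 ∨ y = mid K δ θ + len K δ θ / 2) :
    pt θ (level K δ θ) y ∈ frontier K := by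
  obtain ⟨hpos, h⟩ := chord_level_eq hK hc hδ θ
  have hmem : y ∈ chord K θ (level K δ θ) := by
    rw [h]; rcases hy with rfl | rfl <;> constructor <;> linarith
  refine ⟨subset_closure hmem, fun hint => ?_⟩
  have hsub : (fun y => pt θ (level K δ θ) y) ⁻¹' interior K ⊆ chord K θ (level K δ θ) :=
    fun z hz => (interior_subset hz : pt θ (level K δ θ) z ∈ K)
  have hyi : y ∈ interior (chord K θ (level K δ θ)) := mem_interior.2
    ⟨_, hsub, isOpen_interior.preimage (continuous_pt_snd _ _), hint⟩
  rw [h, interior_Icc] at hyi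
  rcases hy with rfl | rfl
  · exact lt_irrefl _ hyi.1
  · exact lt_irrefl _ hyi.2

lemma hasFDerivAt_area_level :
    HasFDerivAt (fun p : ℝ × ℝ => area K p.1 p.2)
      (len K δ θ • ContinuousLinearMap.snd ℝ ℝ ℝ -
        (len K δ θ * mid K δ θ) • ContinuousLinearMap.fst ℝ ℝ ℝ) (θ, level K δ θ) := by
  obtain ⟨y₀, h0⟩ := exists_pt_level_mem_interior hK hc hδ θ
  have hpos := len_pos hK hc hδ θ
  have h := hasFDerivAt_integral_cut hK hc (f := fun _ => (1 : ℝ)) continuous_const h0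
  simp only [← area_eq_integral] at h
  refine h.congr_fderiv ?_
  have hm : ∫ y in chord K θ (level K δ θ), y = len K δ θ * mid K δ θ := by
    rw [mid]; field_simp
  ext
  · simp [← hm]
  · simp [len]

/-- Since `(θ, d) ↦ (θ, level K d θ)` inverts `(θ, s) ↦ (θ, area K θ s)`, whose derivative is
triangular with diagonal entries 1 and `len K δ θ`, continuity of the inverse and differentiability
at this one point suffice. -/
lemma hasFDerivAt_level :
    HasFDerivAt (fun p : ℝ × ℝ => level K p.2 p.1)
      (mid K δ θ • ContinuousLinearMap.fst ℝ ℝ ℝ +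
        (len K δ θ)⁻¹ • ContinuousLinearMap.snd ℝ ℝ ℝ) (θ, δ) := by
  have hpos := len_pos hK hc hδ θ
  set l := len K δ θ
  set m := mid K δ θ
  have hev : ∀ᶠ p : ℝ × ℝ in 𝓝 (θ, δ), p.2 ∈ Ioo 0 (volume.real K) :=
    continuous_snd.continuousAt.eventually_mem (isOpen_Ioo.mem_nhds hδ)
  let e : (ℝ × ℝ) ≃L[ℝ] (ℝ × ℝ) := ContinuousLinearEquiv.equivOfInverse
    ((ContinuousLinearMap.fst ℝ ℝ ℝ).prod (l • ContinuousLinearMap.snd ℝ ℝ ℝ -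
      (l * m) • ContinuousLinearMap.fst ℝ ℝ ℝ))
    ((ContinuousLinearMap.fst ℝ ℝ ℝ).prod (m • ContinuousLinearMap.fst ℝ ℝ ℝ +
      l⁻¹ • ContinuousLinearMap.snd ℝ ℝ ℝ))
    (fun p => by ext <;> simp; field_simp; ring) (fun p => by ext <;> simp; field_simp; ring)
  have hf : HasFDerivAt (fun p : ℝ × ℝ => (p.1, area K p.1 p.2))
      (e : (ℝ × ℝ) →L[ℝ] (ℝ × ℝ)) ((fun p : ℝ × ℝ => (p.1, level K p.2 p.1)) (θ, δ)) :=
    hasFDerivAt_fst.prodMk (hasFDerivAt_area_level hK hc hδ θ)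
  have hg := HasFDerivAt.of_local_left_inverse (g := fun p : ℝ × ℝ => (p.1, level K p.2 p.1))
    (continuousAt_fst.prodMk (continuousAt_level hK hc hδ θ)) hf (by
      filter_upwards [hev] with p hp
      simp only [area_level hc hp])
  refine hg.snd.congr_fderiv ?_
  ext <;> simp [e]

lemma hasDerivAt_level : HasDerivAt (level K δ) (mid K δ θ) θ := by
  have h1 : HasDerivAt (fun t : ℝ => (t, δ)) ((1 : ℝ), (0 : ℝ)) θ :=
    (hasDerivAt_id θ).prodMk (hasDerivAt_const θ δ)
  simpa [Function.comp_def] using (hasFDerivAt_level hK hc hδ θ).comp_hasDerivAt θ h1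

lemma hasDerivAt_level_area : HasDerivAt (fun d => level K d θ) (len K δ θ)⁻¹ δ := by
  have h1 : HasDerivAt (fun t : ℝ => (θ, t)) ((0 : ℝ), (1 : ℝ)) δ :=
    (hasDerivAt_const δ θ).prodMk (hasDerivAt_id δ)
  simpa [Function.comp_def] using (hasFDerivAt_level hK hc hδ θ).comp_hasDerivAt δ h1

lemma continuous_mid : Continuous (mid K δ) := by
  rw [continuous_iff_continuousAt]
  intro θ
  obtain ⟨y₀, h0⟩ := exists_pt_level_mem_interior hK hc hδ θ
  have hl : ContinuousAt (fun t => (t, level K δ t)) θ :=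
    continuousAt_id.prodMk (hasDerivAt_level hK hc hδ θ).continuousAt
  have h1 := (continuousAt_integral_chord hK hc h0 (continuous_const (y := (1 : ℝ)))).comp_of_eq
    hl rfl
  have h2 := (continuousAt_integral_chord hK hc h0 continuous_id).comp_of_eq hl rfl
  exact h2.div h1 (len_pos hK hc hδ θ).ne'

/-- At constant area the line turns, to first order, about the midpoint of its chord. Only the
second moment `len ^ 3 / 12` of the chord about its midpoint survives in the direction of `θ`; a
thin strip of area `dδ` adds its mass at the midpoint. -/
lemma hasFDerivAt_moment :
    HasFDerivAt (fun p : ℝ × ℝ => ∫ x in K ∩ halfPlane (dir p.1) (level K p.2 p.1), x)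
      ((ContinuousLinearMap.snd ℝ ℝ ℝ).smulRight (pt θ (level K δ θ) (mid K δ θ)) -
        (ContinuousLinearMap.fst ℝ ℝ ℝ).smulRight ((len K δ θ ^ 3 / 12) • nor θ)) (θ, δ) := by
  obtain ⟨y₀, h0⟩ := exists_pt_level_mem_interior hK hc hδ θ
  have hpos := len_pos hK hc hδ θ
  have h := hasFDerivAt_integral_cut hK hc (f := fun x => x) continuous_id h0
  rw [integral_chord_pt hK hc hδ, integral_chord_smul_pt hK hc hδ] at h
  have h2 := HasFDerivAt.comp (g := fun p : ℝ × ℝ => ∫ x in K ∩ halfPlane (dir p.1) p.2, x)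
    (f := fun p : ℝ × ℝ => (p.1, level K p.2 p.1)) (θ, δ) h
    (hasFDerivAt_fst.prodMk (hasFDerivAt_level hK hc hδ θ))
  refine h2.congr_fderiv ?_
  apply ContinuousLinearMap.ext
  rintro ⟨x, y⟩
  simp only [ContinuousLinearMap.comp_apply, _root_.sub_apply,
    ContinuousLinearMap.smulRight_apply, ContinuousLinearMap.prod_apply,
    ContinuousLinearMap.coe_fst', ContinuousLinearMap.coe_snd', _root_.add_apply,
    _root_.smul_apply, smul_eq_mul]
  apply plane_ext <;> simp <;> field_simp <;> ring

lemma hasDerivAt_centroid :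
    HasDerivAt (centroid K δ) (-(len K δ θ ^ 3 / (12 * δ)) • nor θ) θ := by
  have h1 : HasDerivAt (fun t : ℝ => (t, δ)) ((1 : ℝ), (0 : ℝ)) θ :=
    (hasDerivAt_id θ).prodMk (hasDerivAt_const θ δ)
  have h2 := ((hasFDerivAt_moment hK hc hδ θ).comp_hasDerivAt θ h1).const_smul δ⁻¹
  have hδ0 := hδ.1
  convert! h2 using 1
  simp [smul_smul]
  congr 1
  field_simp

lemma hasDerivAt_centroid_area :
    HasDerivAt (fun d => centroid K d θ)
      (δ⁻¹ • (pt θ (level K δ θ) (mid K δ θ) - centroid K δ θ)) δ := by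
  have h1 : HasDerivAt (fun t : ℝ => (θ, t)) ((0 : ℝ), (1 : ℝ)) δ :=
    (hasDerivAt_const δ θ).prodMk (hasDerivAt_id δ)
  have h2 := (hasFDerivAt_moment hK hc hδ θ).comp_hasDerivAt δ h1
  have h3 := (hasDerivAt_inv hδ.1.ne').smul h2
  have hδ0 := hδ.1
  convert! h3 using 1
  simp only [centroid, Function.comp_def]
  apply plane_ext <;> simp <;> field_simp <;> ring

end Level

/-! ### Strictly convex curves and envelopes running on them -/

lemma exists_dir_eq_mem_Ico {b : ℝ → Plane} (hper : ∀ θ, b (θ + 2 * Real.pi) = b θ) (φ a : ℝ) :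
    ∃ ψ ∈ Ico a (a + 2 * Real.pi), b ψ = b φ ∧ dir ψ = dir φ := by
  have hper' : Function.Periodic (fun t => (b t, dir t)) (2 * Real.pi) := fun t => by
    simp only [hper, dir_add_two_pi]
  obtain ⟨ψ, hψ, h⟩ := hper'.exists_mem_Ico Real.two_pi_pos φ a
  exact ⟨ψ, hψ, (congrArg Prod.fst h).symm, (congrArg Prod.snd h).symm⟩

section Rigidity

variable {b : ℝ → Plane} {R : ℝ → ℝ} (hb : ∀ θ, HasDerivAt b (-(R θ) • nor θ) θ)
  (hR : ∀ θ, 0 < R θ) (hper : ∀ θ, b (θ + 2 * Real.pi) = b θ)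

include hb

lemma hasDerivAt_inner_dir_curve (θ φ : ℝ) :
    HasDerivAt (fun t => inner ℝ (dir θ) (b t)) (R φ * Real.sin (φ - θ)) φ := by
  have h := (hasDerivAt_const φ (dir θ)).inner ℝ (hb φ)
  convert! h using 1
  rw [inner_smul_right, inner_dir_nor, inner_zero_left, ← neg_sub φ θ, Real.sin_neg]
  ring

include hR

/-- The derivative of `φ ↦ ⟨dir θ, b φ⟩` is `R φ * sin (φ - θ)`, which is negative on the half turn
before `θ` and positive on the half turn after it. -/
lemma inner_dir_curve_lt {θ φ : ℝ} (hφ : φ ∈ Icc (θ - Real.pi) (θ + Real.pi)) (hne : φ ≠ θ) :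
    inner ℝ (dir θ) (b θ) < inner ℝ (dir θ) (b φ) := by
  have hd := hasDerivAt_inner_dir_curve hb θ
  have hcont : Continuous fun t => inner ℝ (dir θ) (b t) :=
    continuous_iff_continuousAt.2 fun t => (hd t).continuousAt
  rcases lt_or_gt_of_ne hne with h | h
  · refine strictAntiOn_of_deriv_neg (convex_Icc (θ - Real.pi) θ) hcont.continuousOn
      (fun t ht => ?_) ⟨hφ.1, h.le⟩ ⟨by linarith [Real.pi_pos], le_rfl⟩ h
    rw [interior_Icc] at ht
    rw [(hd t).deriv]
    exact mul_neg_of_pos_of_neg (hR t)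
      (Real.sin_neg_of_neg_of_neg_pi_lt (by linarith [ht.2]) (by linarith [ht.1]))
  · refine strictMonoOn_of_deriv_pos (convex_Icc θ (θ + Real.pi)) hcont.continuousOn
      (fun t ht => ?_) ⟨le_rfl, by linarith [Real.pi_pos]⟩ ⟨h.le, hφ.2⟩ h
    rw [interior_Icc] at ht
    rw [(hd t).deriv]
    exact mul_pos (hR t) (Real.sin_pos_of_pos_of_lt_pi (by linarith [ht.1]) (by linarith [ht.2]))

include hper

/-- The line with normal `dir θ` through `b θ` supports the curve. -/
lemma inner_dir_curve_le (θ φ : ℝ) : inner ℝ (dir θ) (b θ) ≤ inner ℝ (dir θ) (b φ) := by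
  obtain ⟨ψ, hψ, h, -⟩ := exists_dir_eq_mem_Ico hper φ (θ - Real.pi)
  rw [← h]
  rcases eq_or_ne ψ θ with rfl | hne
  · rfl
  · exact (inner_dir_curve_lt hb hR ⟨hψ.1, by linarith [hψ.2]⟩ hne).le

lemma dir_eq_of_inner_eq {θ φ : ℝ} (h : inner ℝ (dir θ) (b φ) = inner ℝ (dir θ) (b θ)) :
    dir φ = dir θ := by
  obtain ⟨ψ, hψ, hb', hd⟩ := exists_dir_eq_mem_Ico hper φ (θ - Real.pi)
  rcases eq_or_ne ψ θ with rfl | hne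
  · exact hd.symm
  · have := inner_dir_curve_lt hb hR (θ := θ) (φ := ψ) ⟨hψ.1, by linarith [hψ.2]⟩ hne
    rw [hb', h] at this
    exact absurd this (lt_irrefl _)

/-- The normal is a continuous function of the point of the curve. -/
lemma exists_continuousOn_normal :
    ∃ ν : Plane → Plane, ContinuousOn ν (range b) ∧ ∀ t, ν (b t) = dir t := by
  classical
  have hinj : ∀ s t, b s = b t → dir s = dir t := fun s t h =>
    dir_eq_of_inner_eq hb hR hper (by rw [h])
  let ν : Plane → Plane := fun x => if h : ∃ t, b t = x then dir h.choose else 0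
  have hν : ∀ t, ν (b t) = dir t := fun t => by
    have h : ∃ s, b s = b t := ⟨t, rfl⟩
    simp only [ν, dif_pos h]
    exact hinj _ _ h.choose_spec
  refine ⟨ν, ?_, hν⟩
  have hbc : Continuous b := continuous_iff_continuousAt.2 fun t => (hb t).continuousAt
  rw [continuousOn_iff_isClosed]
  intro C hC
  -- The preimage of `C` under the normal is, within the curve, the image of a compact set of
  -- angles.
  refine ⟨b '' (Icc 0 (2 * Real.pi) ∩ dir ⁻¹' C), ?_, ?_⟩
  · exact ((isCompact_Icc.inter_right (hC.preimage continuous_dir)).image hbc).isClosed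
  · ext x
    constructor
    · rintro ⟨hx, t, rfl⟩
      obtain ⟨ψ, hψ, h1, h2⟩ := exists_dir_eq_mem_Ico hper t 0
      have hx' : dir t ∈ C := by rw [← hν]; exact hx
      refine ⟨⟨ψ, ⟨⟨hψ.1, by linarith [hψ.2]⟩, ?_⟩, h1⟩, t, rfl⟩
      show dir ψ ∈ C
      rwa [h2]
    · rintro ⟨⟨t, ht, rfl⟩, hx⟩
      refine ⟨?_, hx⟩
      show ν (b t) ∈ C
      rw [hν]; exact ht.2

end Rigidity

/-- A vector is controlled by its components along two independent unit vectors `dir θ` and `ν`; the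
loss is the sine of their angle, `⟨nor θ, ν⟩`. -/
lemma norm_mul_abs_le (θ : ℝ) (ν d : Plane) (hν : ‖ν‖ = 1) :
    ‖d‖ * |inner ℝ (nor θ) ν| ≤ 2 * (|inner ℝ ν d| + |inner ℝ (dir θ) d|) := by
  have hn : ‖nor θ‖ = 1 := by
    have h := norm_sq_eq (nor θ)
    simp only [nor_zero_apply, nor_one_apply, neg_sq, Real.sin_sq_add_cos_sq] at h
    nlinarith [norm_nonneg (nor θ)]
  set x := inner ℝ (dir θ) d with hx
  set y := inner ℝ (nor θ) d with hy
  have hd : pt θ x y = d := pt_inner θ d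
  have h1 : ‖d‖ ≤ |x| + |y| := by
    rw [← hd, pt]
    refine (norm_add_le _ _).trans ?_
    rw [norm_smul, norm_smul, norm_dir, hn]
    simp
  set s := inner ℝ (nor θ) ν with hs
  set p := inner ℝ (dir θ) ν with hp
  have h2 : inner ℝ ν d = x * p + y * s := by
    rw [← hd, pt, inner_add_right, inner_smul_right, inner_smul_right, hp, hs,
      real_inner_comm ν, real_inner_comm ν]
  have hp1 : |p| ≤ 1 := by
    simpa [norm_dir, hν] using abs_real_inner_le_norm (dir θ) ν
  have hs1 : |s| ≤ 1 := by
    simpa [hn, hν] using abs_real_inner_le_norm (nor θ) ν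
  have h3 : |y| * |s| ≤ |inner ℝ ν d| + |x| := by
    rw [← abs_mul, show y * s = inner ℝ ν d - x * p by rw [h2]; ring]
    refine (abs_sub _ _).trans ?_
    rw [abs_mul]
    nlinarith [abs_nonneg x]
  nlinarith [abs_nonneg x, abs_nonneg s, abs_nonneg (inner ℝ ν d)]

section Rigidity

variable {b : ℝ → Plane} {R : ℝ → ℝ} (hb : ∀ θ, HasDerivAt b (-(R θ) • nor θ) θ)
  (hR : ∀ θ, 0 < R θ) (hper : ∀ θ, b (θ + 2 * Real.pi) = b θ)
  {k m : ℝ → ℝ} (hk : ∀ θ, HasDerivAt k (m θ) θ) (hm : Continuous m)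
  (hmem : ∀ θ, pt θ (k θ) (m θ) ∈ range b)

include hb hR hper hk hm hmem

/-- An envelope that runs on a smooth strictly convex curve stands still as long as the lines are
not tangent to the curve. -/
lemma hasDerivAt_envelope_zero {ν : Plane → Plane} (hνc : ContinuousOn ν (range b))
    (hν : ∀ t, ν (b t) = dir t) {θ : ℝ}
    (hθ : inner ℝ (nor θ) (ν (pt θ (k θ) (m θ))) ≠ 0) :
    HasDerivAt (fun t => pt t (k t) (m t)) 0 θ := by
  have hkc : Continuous k := continuous_iff_continuousAt.2 fun t => (hk t).continuousAt
  have hec : Continuous fun t => pt t (k t) (m t) :=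
    continuous_pt.comp (continuous_id.prodMk (hkc.prodMk hm))
  set e : ℝ → Plane := fun t => pt t (k t) (m t) with he
  have hNc : Continuous fun t => ν (e t) := hνc.comp_continuous hec hmem
  have hnu : ∀ t, ‖ν (e t)‖ = 1 := fun t => by
    obtain ⟨φ, hφ⟩ := hmem t
    simp only [he, ← hφ, hν, norm_dir]
  have hsup : ∀ s t, 0 ≤ inner ℝ (ν (e s)) (e t - e s) := fun s t => by
    obtain ⟨φ, hφ⟩ := hmem s
    obtain ⟨ψ, hψ⟩ := hmem t
    simp only [he, ← hφ, ← hψ, hν, inner_sub_right]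
    linarith [inner_dir_curve_le hb hR hper φ ψ]
  -- Each of the two points lies on the inner side of the supporting line at the other, so the
  -- displacement has a component of smaller order along the normal.
  have h1 : ∀ t, |inner ℝ (ν (e θ)) (e t - e θ)| ≤ ‖ν (e θ) - ν (e t)‖ * ‖e t - e θ‖ := by
    intro t
    have ha := hsup θ t
    have hb' := hsup t θ
    rw [← neg_sub (e t), inner_neg_right] at hb'
    have hc := real_inner_le_norm (ν (e θ) - ν (e t)) (e t - e θ)
    rw [inner_sub_left] at hc
    rw [abs_of_nonneg ha]
    linarith
  -- Signed distance from the fixed point `e θ` to the moving line; its derivative vanishes at `θ`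
  -- because `e θ` lies on the envelope. No derivative of `m` is needed.
  set q : ℝ → ℝ := fun t => k t - inner ℝ (dir t) (e θ) with hq
  have hqd : HasDerivAt q 0 θ := by
    have := (hk θ).fun_sub ((hasDerivAt_dir θ).inner ℝ (hasDerivAt_const θ (e θ)))
    convert! this using 1
    simp only [he, pt, inner_zero_right, inner_add_right, inner_smul_right, inner_nor_dir,
      inner_nor_nor]
    simp
  have hq0 : q θ = 0 := by simp only [hq, he, inner_dir_pt_self, sub_self]
  have hqe : ∀ t, inner ℝ (dir t) (e t - e θ) = q t := fun t => by
    simp only [hq, inner_sub_right, he, inner_dir_pt_self]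
  have hqo : q =o[𝓝 θ] fun t => t - θ := by
    have := hasDerivAt_iff_isLittleO.1 hqd
    simpa [hq0] using this
  rw [hasDerivAt_iff_isLittleO]
  simp only [smul_zero, sub_zero]
  refine Asymptotics.IsBigO.trans_isLittleO ?_ hqo
  set s := |inner ℝ (nor θ) (ν (e θ))| with hs
  have hspos : 0 < s := abs_pos.2 hθ
  have hev1 : ∀ᶠ t in 𝓝 θ, s / 2 < |inner ℝ (nor t) (ν (e θ))| := by
    have hcont : Continuous fun t => |inner ℝ (nor t) (ν (e θ))| :=
      (continuous_nor.inner continuous_const).abs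
    exact hcont.continuousAt.eventually (lt_mem_nhds (by linarith))
  have hev2 : ∀ᶠ t in 𝓝 θ, ‖ν (e θ) - ν (e t)‖ < s / 8 := by
    have hcont : Continuous fun t => ‖ν (e θ) - ν (e t)‖ := (continuous_const.sub hNc).norm
    exact hcont.continuousAt.eventually (gt_mem_nhds (by simpa using hspos))
  -- With `d = e t - e θ` one gets `‖d‖ * (s / 2) ≤ 2 * (s / 8 * ‖d‖ + |q t|)`, hence `‖d‖ * s ≤ 8 *
  -- |q t|`.
  refine Asymptotics.IsBigO.of_bound (8 / s) ?_
  filter_upwards [hev1, hev2] with t ht1 ht2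
  have hmain := norm_mul_abs_le t (ν (e θ)) (e t - e θ) (hnu θ)
  rw [hqe] at hmain
  have h1t := h1 t
  have hd := norm_nonneg (e t - e θ)
  rw [Real.norm_eq_abs, div_mul_eq_mul_div, le_div_iff₀ hspos]
  nlinarith

/-- An envelope that runs on a smooth strictly convex curve consists of its tangents. -/
theorem envelope_rigidity (hne : ∀ θ, k (θ + Real.pi) ≠ -k θ) :
    (∀ θ, k θ = inner ℝ (dir θ) (b θ)) ∨ ∀ θ, k θ = inner ℝ (dir θ) (b (θ + Real.pi)) := by
  obtain ⟨ν, hνc, hν⟩ := exists_continuousOn_normal hb hR hper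
  have hkc : Continuous k := continuous_iff_continuousAt.2 fun t => (hk t).continuousAt
  have hec : Continuous fun t => pt t (k t) (m t) :=
    continuous_pt.comp (continuous_id.prodMk (hkc.prodMk hm))
  have hNc : Continuous fun t => ν (pt t (k t) (m t)) := hνc.comp_continuous hec hmem
  have hsc : Continuous fun t => inner ℝ (nor t) (ν (pt t (k t) (m t))) :=
    continuous_nor.inner hNc
  have hke : ∀ t, k t = inner ℝ (dir t) (pt t (k t) (m t)) := fun t =>
    (inner_dir_pt_self _ _ _).symm
  have hU : ∀ θ, inner ℝ (nor θ) (ν (pt θ (k θ) (m θ))) = 0 := by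
    by_contra! hcon
    obtain ⟨θ₀, hθ₀⟩ := hcon
    obtain ⟨c, hc⟩ := hmem θ₀
    set x₀ := pt θ₀ (k θ₀) (m θ₀) with hx₀
    have hsin : Real.sin (c - θ₀) ≠ 0 := by
      rwa [← hc, hν, inner_nor_dir] at hθ₀
    -- The angles at which the line is parallel to the tangent at `x₀ = b c` are `c + ℤπ`; `(α, α +
    -- π)` is the gap between two of them that contains `θ₀`. The envelope stays at `x₀` on the
    -- whole gap, hence also at its ends, where the two lines coincide.
    set n := ⌊(θ₀ - c) / Real.pi⌋ with hn
    set α := c + n * Real.pi with hα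
    have hpi := Real.pi_pos
    have hsinα : ∀ t ∈ Ioo α (α + Real.pi), Real.sin (c - t) ≠ 0 := by
      intro t ht h0
      have h1 : Real.sin (t - α) = 0 := by
        rw [hα, ← sub_sub, Real.sin_sub_int_mul_pi, ← neg_sub, Real.sin_neg, h0]
        simp
      exact (Real.sin_pos_of_pos_of_lt_pi (by linarith [ht.1]) (by linarith [ht.2])).ne' h1
    have hθα : θ₀ ∈ Ioo α (α + Real.pi) := by
      have h1 : (n : ℝ) ≤ (θ₀ - c) / Real.pi := Int.floor_le _
      have h2 : (θ₀ - c) / Real.pi < n + 1 := Int.lt_floor_add_one _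
      rw [le_div_iff₀ hpi] at h1
      rw [div_lt_iff₀ hpi] at h2
      refine ⟨lt_of_le_of_ne (by linarith) fun h => hsin ?_, by linarith⟩
      rw [← h, hα, sub_add_cancel_left, Real.sin_neg, Real.sin_int_mul_pi, neg_zero]
    have hloc : ∀ t ∈ Ioo α (α + Real.pi), pt t (k t) (m t) = x₀ →
        ∀ᶠ t' in 𝓝 t, pt t' (k t') (m t') = x₀ := by
      intro t ht hte
      have hst : inner ℝ (nor t) (ν (pt t (k t) (m t))) ≠ 0 := by
        rw [hte, ← hc, hν, inner_nor_dir]; exact hsinα t ht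
      obtain ⟨ε, hε, hball⟩ := Metric.eventually_nhds_iff_ball.1
        (hsc.continuousAt.eventually_ne hst)
      filter_upwards [Metric.ball_mem_nhds t hε] with t' ht'
      rw [← hte]
      have hd : ∀ r ∈ Metric.ball t ε, HasDerivWithinAt (fun t => pt t (k t) (m t)) 0
          (Metric.ball t ε) r := fun r hr =>
        (hasDerivAt_envelope_zero hb hR hper hk hm hmem hνc hν (hball r hr)).hasDerivWithinAt
      have := (convex_ball t ε).norm_image_sub_le_of_norm_hasDerivWithin_le hd
        (fun r _ => (norm_zero (E := Plane)).le) (Metric.mem_ball_self hε) ht'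
      rw [zero_mul] at this
      exact sub_eq_zero.1 (norm_le_zero_iff.1 this)
    have hclosed : IsClosed {t | pt t (k t) (m t) = x₀} := isClosed_eq hec continuous_const
    have hsub : Ioo α (α + Real.pi) ⊆ {t | ∀ᶠ t' in 𝓝 t, pt t' (k t') (m t') = x₀} := by
      refine isPreconnected_Ioo.subset_of_closure_inter_subset isOpen_setOfPred_eventually_nhds
        ⟨θ₀, hθα, hloc θ₀ hθα rfl⟩ ?_
      rintro t ⟨ht, htI⟩
      refine hloc t htI ?_
      have : closure {t | ∀ᶠ t' in 𝓝 t, pt t' (k t') (m t') = x₀} ⊆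
          {t | pt t (k t) (m t) = x₀} :=
        closure_minimal (fun r hr => Eventually.self_of_nhds hr) hclosed
      exact this ht
    have hIcc : Icc α (α + Real.pi) ⊆ {t | pt t (k t) (m t) = x₀} := by
      rw [← closure_Ioo (by linarith)]
      exact closure_minimal (fun r hr => Eventually.self_of_nhds (hsub hr)) hclosed
    have h1 : pt α (k α) (m α) = x₀ := hIcc ⟨le_rfl, by linarith⟩
    have h2 : pt (α + Real.pi) (k (α + Real.pi)) (m (α + Real.pi)) = x₀ :=
      hIcc ⟨by linarith, le_rfl⟩
    apply hne α
    rw [hke (α + Real.pi), hke α, h1, h2, dir_add_pi, inner_neg_left]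
  choose φ hφ using hmem
  have hNdir : ∀ t, ν (pt t (k t) (m t)) = dir (φ t) := fun t => by rw [← hφ, hν]
  have hdec : ∀ t, dir (φ t) = inner ℝ (dir t) (ν (pt t (k t) (m t))) • dir t := by
    intro t
    have h1 := pt_inner t (ν (pt t (k t) (m t)))
    rw [hU t, pt, zero_smul, add_zero] at h1
    rw [h1, hNdir]
  have hsq : ∀ t, inner ℝ (dir t) (ν (pt t (k t) (m t))) ^ 2 = 1 := by
    intro t
    have h1 := congrArg norm (hdec t)
    rw [norm_smul, norm_dir, norm_dir, mul_one, Real.norm_eq_abs] at h1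
    rw [← sq_abs, ← h1, one_pow]
  have hcc : Continuous fun t => inner ℝ (dir t) (ν (pt t (k t) (m t))) :=
    continuous_dir.inner hNc
  have htan : ∀ t ψ, dir (φ t) = dir ψ → inner ℝ (dir ψ) (pt t (k t) (m t)) =
      inner ℝ (dir ψ) (b ψ) := by
    intro t ψ h
    rw [← hφ]
    have h1 := inner_dir_curve_le hb hR hper (φ t) ψ
    have h2 := inner_dir_curve_le hb hR hper ψ (φ t)
    rw [h] at h1
    exact le_antisymm h1 h2
  -- The normal of the curve at the envelope point is `± dir t`, and by continuity the sign does not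
  -- depend on `t`.
  rcases isPreconnected_univ.eq_or_eq_neg_of_sq_eq hcc.continuousOn
    (continuousOn_const (c := (1 : ℝ))) (fun t _ => by simpa using hsq t)
    (fun _ => one_ne_zero) with h | h
  · left
    intro t
    have h1 : inner ℝ (dir t) (ν (pt t (k t) (m t))) = 1 := h (mem_univ t)
    rw [hke t]
    exact htan t t (by rw [hdec, h1, one_smul])
  · right
    intro t
    have h1 : inner ℝ (dir t) (ν (pt t (k t) (m t))) = -1 := h (mem_univ t)
    have := htan t (t + Real.pi) (by rw [hdec, h1, dir_add_pi, neg_one_smul])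
    rw [dir_add_pi, inner_neg_left, inner_neg_left] at this
    rw [hke t]
    linarith

end Rigidity

/-! ### Periodicity and a delayed Ermakov equation -/

lemma level_add_two_pi (K : Set Plane) (δ θ : ℝ) :
    level K δ (θ + 2 * Real.pi) = level K δ θ := by
  simp only [level, area, dir_add_two_pi]

lemma len_add_two_pi (K : Set Plane) (δ θ : ℝ) : len K δ (θ + 2 * Real.pi) = len K δ θ := by
  simp only [len, level_add_two_pi, chord, pt, dir_add_two_pi, nor_add_two_pi]

lemma centroid_add_two_pi (K : Set Plane) (δ θ : ℝ) :
    centroid K δ (θ + 2 * Real.pi) = centroid K δ θ := by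
  simp only [centroid, level_add_two_pi, dir_add_two_pi]

lemma exists_forall_le_of_periodic {f : ℝ → ℝ} (hf : Continuous f) {T : ℝ} (hT : 0 < T)
    (hper : ∀ x, f (x + T) = f x) : ∃ x₀, ∀ x, f x ≤ f x₀ := by
  obtain ⟨x₀, -, h⟩ := isCompact_Icc.exists_isMaxOn (nonempty_Icc.2 hT.le) hf.continuousOn
  refine ⟨x₀, fun x => ?_⟩
  obtain ⟨y, hy, hxy⟩ := (show Function.Periodic f T from hper).exists_mem_Ico₀ hT x
  rw [hxy]
  exact h ⟨hy.1, hy.2.le⟩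

lemma second_deriv_nonpos_of_forall_le {f g : ℝ → ℝ} (hf : ∀ x, HasDerivAt f (g x) x) {x₀ c : ℝ}
    (hmax : ∀ x, f x ≤ f x₀) (hg : HasDerivAt g c x₀) : c ≤ 0 := by
  have h0 : g x₀ = 0 :=
    IsLocalMax.hasDerivAt_eq_zero (Eventually.of_forall hmax) (hf x₀)
  by_contra! hc
  have hpos : ∀ᶠ x in 𝓝[>] x₀, 0 < g x := by
    have h1 := (hasDerivAt_iff_tendsto_slope.1 hg).eventually (lt_mem_nhds hc)
    have h2 : ∀ᶠ x in 𝓝[>] x₀, 0 < slope g x₀ x :=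
      h1.filter_mono (nhdsWithin_mono _ fun x hx => ne_of_gt hx)
    filter_upwards [h2, self_mem_nhdsWithin] with x hx hxx
    rw [slope_def_field, h0, sub_zero] at hx
    have hxx' : 0 < x - x₀ := sub_pos.2 hxx
    exact (div_pos_iff_of_pos_right hxx').1 hx
  obtain ⟨x₁, hx₁, hsub⟩ := mem_nhdsGT_iff_exists_Ioo_subset.1 hpos
  obtain ⟨y, hy, hslope⟩ := exists_hasDerivAt_eq_slope f g (show x₀ < x₁ from hx₁)
    (fun x _ => (hf x).continuousAt.continuousWithinAt) (fun x _ => hf x)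
  have hgy : 0 < g y := hsub hy
  rw [hslope, div_pos_iff_of_pos_right (sub_pos.2 hx₁)] at hgy
  linarith [hmax x₁]

/-- Positive `2π`-periodic solutions of a delayed Ermakov equation are `π`-periodic. -/
lemma ermakov_pi_periodic {u u' : ℝ → ℝ} {a b : ℝ} (hb : b ≤ 0) (hpos : ∀ x, 0 < u x)
    (hper : ∀ x, u (x + 2 * Real.pi) = u x) (hu : ∀ x, HasDerivAt u (u' x) x)
    (hu' : ∀ x, HasDerivAt u' (a / u (x + Real.pi) ^ 3 + b / u x ^ 3 - u x) x) (x : ℝ) :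
    u (x + Real.pi) = u x := by
  have hpp : ∀ x, u (x + Real.pi + Real.pi) = u x := fun x => by
    rw [add_assoc, ← two_mul, hper]
  have huc : Continuous u := continuous_iff_continuousAt.2 fun x => (hu x).continuousAt
  have ht : ∀ x, HasDerivAt (fun x => u (x + Real.pi)) (u' (x + Real.pi)) x := fun x =>
    (hu (x + Real.pi)).comp_add_const x Real.pi
  have ht' : ∀ x, HasDerivAt (fun x => u' (x + Real.pi))
      (a / u x ^ 3 + b / u (x + Real.pi) ^ 3 - u (x + Real.pi)) x := fun x => by
    have := (hu' (x + Real.pi)).comp_add_const x Real.pi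
    rwa [hpp] at this
  have htc : Continuous fun x => u (x + Real.pi) := by fun_prop
  -- At a minimum of `u x + u (x + π)` the second derivative, `(a + b)` times a positive number
  -- minus the sum itself, is non-negative.
  have hs : 0 < a + b := by
    obtain ⟨x₀, hx₀⟩ := exists_forall_le_of_periodic (f := fun x => -(u x + u (x + Real.pi)))
      (huc.add htc).neg Real.pi_pos (fun x => by rw [hpp]; ring)
    have h := second_deriv_nonpos_of_forall_le (fun x => ((hu x).fun_add (ht x)).fun_neg) hx₀
      ((hu' x₀).fun_add (ht' x₀)).fun_neg
    have h1 := hpos x₀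
    have h2 := hpos (x₀ + Real.pi)
    have h3 : 0 < (a + b) * (1 / u x₀ ^ 3 + 1 / u (x₀ + Real.pi) ^ 3) := by
      have : (a + b) * (1 / u x₀ ^ 3 + 1 / u (x₀ + Real.pi) ^ 3) =
        a / u (x₀ + Real.pi) ^ 3 + b / u x₀ ^ 3 +
          (a / u x₀ ^ 3 + b / u (x₀ + Real.pi) ^ 3) := by ring
      rw [this]
      linarith
    exact pos_of_mul_pos_left h3 (by positivity)
  have hle : ∀ x, u x ≤ u (x + Real.pi) := by
    have hp0 : ∀ x, u x + u (x + Real.pi) ≠ 0 := fun x =>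
      (add_pos (hpos x) (hpos (x + Real.pi))).ne'
    -- In the numerator of the derivative of this quotient, a Wronskian of difference and sum, the
    -- linear terms `-u` cancel after one more differentiation. What remains has a sign.
    obtain ⟨x₀, hx₀⟩ := exists_forall_le_of_periodic
      (f := fun x => (u x - u (x + Real.pi)) / (u x + u (x + Real.pi)))
      ((huc.sub htc).div (huc.add htc) hp0) Real.two_pi_pos
      (fun x => by rw [add_right_comm, hper, hper])
    have hd : ∀ x, HasDerivAt (fun x => (u x - u (x + Real.pi)) / (u x + u (x + Real.pi)))
        (((u' x - u' (x + Real.pi)) * (u x + u (x + Real.pi)) -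
          (u x - u (x + Real.pi)) * (u' x + u' (x + Real.pi))) /
            (u x + u (x + Real.pi)) ^ 2) x := fun x =>
      ((hu x).fun_sub (ht x)).fun_div ((hu x).fun_add (ht x)) (hp0 x)
    have hW0 : (u' x₀ - u' (x₀ + Real.pi)) * (u x₀ + u (x₀ + Real.pi)) -
        (u x₀ - u (x₀ + Real.pi)) * (u' x₀ + u' (x₀ + Real.pi)) = 0 := by
      have := IsLocalMax.hasDerivAt_eq_zero (Eventually.of_forall hx₀) (hd x₀)
      rwa [div_eq_zero_iff, or_iff_left (pow_ne_zero 2 (hp0 x₀))] at this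
    have hW := ((((hu' x₀).fun_sub (ht' x₀)).fun_mul ((hu x₀).fun_add (ht x₀))).fun_sub
      (((hu x₀).fun_sub (ht x₀)).fun_mul ((hu' x₀).fun_add (ht' x₀))))
    have hdd := hW.fun_div (((hu x₀).fun_add (ht x₀)).fun_pow 2) (pow_ne_zero 2 (hp0 x₀))
    have hn := second_deriv_nonpos_of_forall_le hd hx₀ hdd
    rw [hW0, zero_mul, sub_zero] at hn
    have h1 := hpos x₀
    have h2 := hpos (x₀ + Real.pi)
    have hx₀le : u x₀ ≤ u (x₀ + Real.pi) := by
      by_contra! hlt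
      set p := u x₀
      set q := u (x₀ + Real.pi)
      have hqp : 1 / p ^ 3 < 1 / q ^ 3 := by
        apply one_div_lt_one_div_of_lt (by positivity)
        gcongr
      have hqp2 : 1 / p ^ 2 < 1 / q ^ 2 := by
        apply one_div_lt_one_div_of_lt (by positivity)
        gcongr
      rw [div_le_iff₀ (by positivity), zero_mul] at hn
      have hn' := nonpos_of_mul_nonpos_left hn (by positivity)
      -- This is the derivative of the Wronskian at `x₀`, regrouped so that `b ≤ 0` and `a + b > 0`
      -- make both terms non-negative when `p > q`; at a maximum it cannot be positive.
      have key : 0 < -2 * b * ((1 / q ^ 3 - 1 / p ^ 3) * (p + q)) +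
          (a + b) * (2 * (1 / q ^ 2 - 1 / p ^ 2)) := by
        have k1 : 0 ≤ -2 * b * ((1 / q ^ 3 - 1 / p ^ 3) * (p + q)) :=
          mul_nonneg (by linarith) (mul_nonneg (by linarith) (by linarith))
        have k2 : 0 < (a + b) * (2 * (1 / q ^ 2 - 1 / p ^ 2)) := mul_pos hs (by linarith)
        linarith
      refine absurd key (not_lt_of_ge (le_trans (le_of_eq ?_) hn'))
      field_simp
      ring
    intro x
    have h3 := hx₀ x
    have h4 : (u x₀ - u (x₀ + Real.pi)) / (u x₀ + u (x₀ + Real.pi)) ≤ 0 :=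
      div_nonpos_of_nonpos_of_nonneg (by linarith) (by linarith)
    have h5 := (h3.trans h4)
    have h6 : 0 < u x + u (x + Real.pi) := add_pos (hpos x) (hpos (x + Real.pi))
    have h7 := (div_nonpos_iff).1 h5
    rcases h7 with h7 | h7 <;> linarith [h7.1, h7.2]
  have h1 := hle x
  have h2 := hle (x + Real.pi)
  rw [hpp] at h2
  exact le_antisymm h2 h1

/-! ### Tangential areas and the equation for the inverse chord length -/

/-- The lines that cut off the area `δ` are tangents of a homothetic image of the curve of
buoyancy, where parallel tangents are in correspondence; `σ ∈ {0, π}` tells which of the two. -/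
def IsTangential (K : Set Plane) (σ δ : ℝ) : Prop :=
  ∃ (r : ℝ) (w : Plane), ∀ θ, level K δ θ = inner ℝ (dir θ) (r • centroid K δ (θ + σ) + w)

/-- The ratio of the homothety in `IsTangential`. -/
noncomputable def ratio (K : Set Plane) (σ δ : ℝ) : ℝ :=
  (level K δ 0 + level K δ Real.pi) /
    inner ℝ (dir 0) (centroid K δ (0 + σ) - centroid K δ (Real.pi + σ))

/-- The translation part of the homothety in `IsTangential`. -/
noncomputable def shift (K : Set Plane) (σ δ : ℝ) : Plane :=
  pt 0 (level K δ 0 - ratio K σ δ * inner ℝ (dir 0) (centroid K δ (0 + σ)))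
    (level K δ (Real.pi / 2) -
      ratio K σ δ * inner ℝ (dir (Real.pi / 2)) (centroid K δ (Real.pi / 2 + σ)))

section

variable {K : Set Plane} (hK : Convex ℝ K) (hc : IsCompact K) {δ : ℝ}
  (hδ : δ ∈ Ioo 0 (volume.real K)) {σ : ℝ} (hσ : σ = 0 ∨ σ = Real.pi)

include hK hc hδ

lemma curvature_radius_pos (θ : ℝ) : 0 < len K δ θ ^ 3 / (12 * δ) := by
  have := len_pos hK hc hδ θ
  have := hδ.1
  positivity

lemma inner_centroid_lt (θ : ℝ) :
    inner ℝ (dir θ) (centroid K δ θ) < inner ℝ (dir θ) (centroid K δ (θ + Real.pi)) :=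
  inner_dir_curve_lt (hasDerivAt_centroid hK hc hδ) (curvature_radius_pos hK hc hδ)
    ⟨by linarith [Real.pi_pos], le_rfl⟩ (by linarith [Real.pi_pos])

lemma hasDerivAt_centroid_add (σ θ : ℝ) :
    HasDerivAt (fun t => centroid K δ (t + σ))
      (-(len K δ (θ + σ) ^ 3 / (12 * δ)) • nor (θ + σ)) θ :=
  (hasDerivAt_centroid hK hc hδ (θ + σ)).comp_add_const θ σ

include hσ

lemma ratio_denom_ne_zero :
    inner ℝ (dir 0) (centroid K δ (0 + σ) - centroid K δ (Real.pi + σ)) ≠ 0 := by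
  have h := inner_centroid_lt hK hc hδ 0
  rw [inner_sub_right]
  rcases hσ with rfl | rfl
  · rw [add_zero, add_zero]
    rw [zero_add] at h
    linarith
  · rw [← two_mul, ← zero_add (2 * Real.pi), centroid_add_two_pi]
    linarith

/-- Ratio and translation are forced: adding the levels at opposite angles eliminates `w`, and the
levels at `0` and `π / 2` then give its coordinates. Explicit formulas make both differentiable in
`δ`. -/
lemma isTangential_iff : IsTangential K σ δ ↔ ∀ θ, level K δ θ =
    inner ℝ (dir θ) (ratio K σ δ • centroid K δ (θ + σ) + shift K σ δ) := by
  refine ⟨?_, fun h => ⟨_, _, h⟩⟩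
  rintro ⟨r, w, h⟩
  have hdirpi : dir Real.pi = -dir 0 := by rw [← dir_add_pi, zero_add]
  have hr : ratio K σ δ = r := by
    rw [ratio, div_eq_iff (ratio_denom_ne_zero hK hc hδ hσ), h 0, h Real.pi, hdirpi]
    simp only [inner_add_right, inner_smul_right, inner_neg_left, inner_sub_right]
    ring
  have hw : shift K σ δ = w := by
    rw [shift, hr, h 0, h (Real.pi / 2)]
    simp only [inner_add_right, inner_smul_right, add_sub_cancel_left]
    have : dir (Real.pi / 2) = nor 0 := by apply plane_ext <;> simp
    rw [this, pt_inner]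
  rw [hr, hw]
  exact h

lemma differentiableAt_ratio : DifferentiableAt ℝ (ratio K σ) δ := by
  have hl : ∀ θ, DifferentiableAt ℝ (fun d => level K d θ) δ := fun θ =>
    (hasDerivAt_level_area hK hc hδ θ).differentiableAt
  have hb : ∀ θ, DifferentiableAt ℝ (fun d => centroid K d θ) δ := fun θ =>
    (hasDerivAt_centroid_area hK hc hδ θ).differentiableAt
  exact ((hl 0).add (hl Real.pi)).div
    ((differentiableAt_const (dir 0)).inner ℝ ((hb _).sub (hb _)))
    (ratio_denom_ne_zero hK hc hδ hσ)

lemma differentiableAt_shift : DifferentiableAt ℝ (shift K σ) δ := by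
  have hl : ∀ θ, DifferentiableAt ℝ (fun d => level K d θ) δ := fun θ =>
    (hasDerivAt_level_area hK hc hδ θ).differentiableAt
  have hb : ∀ θ φ, DifferentiableAt ℝ (fun d => inner ℝ (dir φ) (centroid K d θ)) δ := fun θ φ =>
    (differentiableAt_const (dir φ)).inner ℝ (hasDerivAt_centroid_area hK hc hδ θ).differentiableAt
  have hr := differentiableAt_ratio hK hc hδ hσ
  exact (((hl 0).sub (hr.mul (hb _ _))).smul_const (dir 0)).add
    (((hl _).sub (hr.mul (hb _ _))).smul_const (nor 0))

lemma hasDerivAt_inner_dir_centroid_add (θ : ℝ) :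
    HasDerivAt (fun t => inner ℝ (dir t) (centroid K δ (t + σ)))
      (inner ℝ (nor θ) (centroid K δ (θ + σ))) θ := by
  have h := (hasDerivAt_dir θ).inner ℝ (hasDerivAt_centroid_add hK hc hδ σ θ)
  convert! h using 1
  rw [inner_smul_right, inner_dir_nor]
  rcases hσ with rfl | rfl <;> simp

/-- Differentiating the tangency relation in `θ` identifies the other coordinate, since the
derivative of the level is `mid`. -/
lemma pt_eq_of_tangential {r : ℝ} {w : Plane}
    (h : ∀ θ, level K δ θ = inner ℝ (dir θ) (r • centroid K δ (θ + σ) + w)) (θ : ℝ) :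
    pt θ (level K δ θ) (mid K δ θ) = r • centroid K δ (θ + σ) + w := by
  have h1 := hasDerivAt_level hK hc hδ θ
  have h2 : HasDerivAt (level K δ) (r * inner ℝ (nor θ) (centroid K δ (θ + σ)) +
      inner ℝ (nor θ) w) θ := by
    have := ((hasDerivAt_inner_dir_centroid_add hK hc hδ hσ θ).const_mul r).add
      ((hasDerivAt_dir θ).inner ℝ (hasDerivAt_const θ w))
    rw [inner_zero_right, zero_add] at this
    convert! this using 1
    ext t
    rw [h, inner_add_right, inner_smul_right]
    rfl
  have h3 : mid K δ θ = inner ℝ (nor θ) (r • centroid K δ (θ + σ) + w) := by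
    rw [h1.unique h2, inner_add_right, inner_smul_right]
  rw [h3, h, pt_inner]

/-- If the tangency persists under small changes of the area, then the inverse length of the
chord is a combination of support functions. -/
lemma exists_inv_len_eq (h : ∀ᶠ d in 𝓝 δ, IsTangential K σ d) :
    ∃ (A B : ℝ) (v : Plane), 0 ≤ B ∧ ∀ θ, (len K δ θ)⁻¹ =
      inner ℝ (dir θ) (A • centroid K δ (θ + σ) + B • centroid K δ θ + v) := by
  set r := ratio K σ δ with hr
  set w := shift K σ δ with hw
  have hδ0 := hδ.1
  have htan := (isTangential_iff hK hc hδ hσ).1 h.self_of_nhds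
  have hev : ∀ᶠ d in 𝓝 δ, ∀ θ, level K d θ =
      inner ℝ (dir θ) (ratio K σ d • centroid K d (θ + σ) + shift K σ d) := by
    filter_upwards [h, isOpen_Ioo.mem_nhds hδ] with d hd hd'
    exact (isTangential_iff hK hc hd' hσ).1 hd
  -- The constants come from differentiating `r • b(θ + σ) + w` in `δ`: the derivative of `b(θ + σ)`
  -- contains the chord midpoint at `θ + σ`, which is `r • b(θ + 2σ) + w = r • b(θ) + w`. This is
  -- the source of `B = r ^ 2 / δ ≥ 0`.
  refine ⟨deriv (ratio K σ) δ - r / δ, r ^ 2 / δ, deriv (shift K σ) δ + (r / δ) • w,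
    by positivity, fun θ => ?_⟩
  have h1 := hasDerivAt_level_area hK hc hδ θ
  have h2 := (hasDerivAt_const δ (dir θ)).inner ℝ
    (((differentiableAt_ratio hK hc hδ hσ).hasDerivAt.smul
      (hasDerivAt_centroid_area hK hc hδ (θ + σ))).add
        (differentiableAt_shift hK hc hδ hσ).hasDerivAt)
  have h3 := h1.unique (h2.congr_of_eventuallyEq (by
    filter_upwards [hev] with d hd
    rw [hd]; rfl))
  have hbb : centroid K δ (θ + σ + σ) = centroid K δ θ := by
    rcases hσ with rfl | rfl
    · simp
    · rw [add_assoc, ← two_mul, centroid_add_two_pi]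
  rw [h3, inner_zero_left, add_zero, pt_eq_of_tangential hK hc hδ hσ htan, hbb, ← hr, ← hw]
  simp only [inner_add_right, inner_smul_right, inner_sub_right]
  field_simp
  ring

end

section

variable {K : Set Plane} (hK : Convex ℝ K) (hc : IsCompact K) {δ : ℝ}
  (hδ : δ ∈ Ioo 0 (volume.real K))

include hK hc hδ

lemma hasDerivAt_inner_nor_centroid (θ : ℝ) :
    HasDerivAt (fun t => inner ℝ (nor t) (centroid K δ t))
      (-inner ℝ (dir θ) (centroid K δ θ) - len K δ θ ^ 3 / (12 * δ)) θ := by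
  have h := (hasDerivAt_nor θ).inner ℝ (hasDerivAt_centroid hK hc hδ θ)
  convert! h using 1
  rw [inner_smul_right, inner_nor_nor, inner_neg_left, sub_self, Real.cos_zero]
  ring

lemma hasDerivAt_inner_nor_centroid_add_pi (θ : ℝ) :
    HasDerivAt (fun t => inner ℝ (nor t) (centroid K δ (t + Real.pi)))
      (-inner ℝ (dir θ) (centroid K δ (θ + Real.pi)) +
        len K δ (θ + Real.pi) ^ 3 / (12 * δ)) θ := by
  have h := (hasDerivAt_nor θ).inner ℝ (hasDerivAt_centroid_add hK hc hδ Real.pi θ)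
  convert! h using 1
  rw [inner_smul_right, nor_add_pi, inner_neg_right, inner_nor_nor, inner_neg_left, sub_self,
    Real.cos_zero]
  ring

/-- The case of the opposite parallel tangents reduces to the other one. -/
lemma isTangential_zero_of_pi (h : ∀ᶠ d in 𝓝 δ, IsTangential K Real.pi d) :
    IsTangential K 0 δ := by
  have hδ0 := hδ.1
  obtain ⟨A, B, v, hB, hU⟩ := exists_inv_len_eq hK hc hδ (Or.inr rfl) h
  have hlen : ∀ θ, len K δ θ ^ 3 / (12 * δ) = (12 * δ)⁻¹ / ((len K δ θ)⁻¹) ^ 3 := fun θ => by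
    have := len_pos hK hc hδ θ
    field_simp
  -- Each support function plus its second derivative is, up to sign, a radius of curvature, and
  -- these are multiples of `1 / u ^ 3`. The opposite support function enters with the opposite
  -- sign, hence `b ≤ 0`.
  have hper := ermakov_pi_periodic (u := fun θ => (len K δ θ)⁻¹)
    (u' := fun θ => inner ℝ (nor θ) (A • centroid K δ (θ + Real.pi) + B • centroid K δ θ + v))
    (a := A * (12 * δ)⁻¹) (b := -(B * (12 * δ)⁻¹))
    (neg_nonpos.2 (by positivity)) (fun θ => inv_pos.2 (len_pos hK hc hδ θ))
    (fun θ => by rw [len_add_two_pi]) ?_ ?_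
  · have hlp : ∀ θ, len K δ (θ + Real.pi) = len K δ θ := fun θ => inv_inj.1 (hper θ)
    have hd : ∀ θ, HasDerivAt (fun t => centroid K δ t + centroid K δ (t + Real.pi)) 0 θ := by
      intro θ
      have := (hasDerivAt_centroid hK hc hδ θ).add
        (hasDerivAt_centroid_add hK hc hδ Real.pi θ)
      rw [hlp, nor_add_pi, smul_neg, add_neg_cancel] at this
      exact this
    have hconst : ∀ θ, centroid K δ θ + centroid K δ (θ + Real.pi) =
        centroid K δ 0 + centroid K δ (0 + Real.pi) := fun θ =>
      is_const_of_deriv_eq_zero (fun t => (hd t).differentiableAt) (fun t => (hd t).deriv) θ 0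
    obtain ⟨r, w, hrw⟩ := h.self_of_nhds
    -- Chords of opposite directions have equal length, so the curve of buoyancy is centrally
    -- symmetric and `b(θ + π)` may be replaced by a constant minus `b(θ)`.
    refine ⟨-r, w + r • (centroid K δ 0 + centroid K δ (0 + Real.pi)), fun θ => ?_⟩
    rw [hrw, ← hconst θ, add_zero]
    congr 1
    module
  · intro θ
    have h1 := ((hasDerivAt_inner_dir_centroid_add hK hc hδ (σ := Real.pi) (Or.inr rfl)
      θ).const_mul A).add ((((hasDerivAt_inner_dir_centroid_add hK hc hδ (σ := 0) (Or.inl rfl)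
      θ)).const_mul B).add ((hasDerivAt_dir θ).inner ℝ (hasDerivAt_const θ v)))
    simp only [add_zero, inner_zero_right, zero_add] at h1
    convert! h1 using 1
    · ext t
      rw [hU]
      simp only [inner_add_right, inner_smul_right, Pi.add_apply]
      ring
    · simp only [inner_add_right, inner_smul_right]
      ring
  · intro θ
    have h1 := ((hasDerivAt_inner_nor_centroid_add_pi hK hc hδ θ).const_mul A).add
      (((hasDerivAt_inner_nor_centroid hK hc hδ θ).const_mul B).add
        ((hasDerivAt_nor θ).inner ℝ (hasDerivAt_const θ v)))
    simp only [inner_zero_right, zero_add, inner_neg_left] at h1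
    convert! h1 using 1
    · ext t
      simp only [inner_add_right, inner_smul_right, Pi.add_apply]
      ring
    · rw [hlen, hlen, hU θ]
      simp only [inner_add_right, inner_smul_right]
      ring

end

/-! ### Recognizing the ellipse -/

/-- The set contains the disc as the convex hull of the circle. A further point would lie outside
the disc and push the point of the circle on its ray into the interior. -/
lemma closedBall_eq_of_sphere_subset_frontier {L : Set Plane} (hL : Convex ℝ L) (hc : IsClosed L)
    (h : Metric.sphere 0 1 ⊆ frontier L) : Metric.closedBall 0 1 = L := by
  have hsub : Metric.closedBall (0 : Plane) 1 ⊆ L := by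
    rw [← convexHull_sphere_eq_closedBall 0 zero_le_one]
    exact convexHull_min (h.trans hc.frontier_subset) hL
  refine hsub.antisymm fun x hx => ?_
  by_contra hx1
  rw [mem_closedBall_zero_iff, not_le] at hx1
  have h0 : (0 : Plane) ∈ interior L := interior_mono hsub
    (Metric.ball_subset_interior_closedBall (Metric.mem_ball_self one_pos))
  have hpos : 0 < ‖x‖ := one_pos.trans hx1
  have hint : ‖x‖⁻¹ • x ∈ interior L := by
    apply hL.openSegment_interior_self_subset_interior h0 hx
    refine ⟨1 - ‖x‖⁻¹, ‖x‖⁻¹, ?_, by positivity, by ring, by simp⟩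
    have := inv_lt_one_of_one_lt₀ hx1
    linarith
  have hs : ‖x‖⁻¹ • x ∈ Metric.sphere (0 : Plane) 1 := by
    rw [mem_sphere_zero_iff_norm, norm_smul, norm_inv, norm_norm, inv_mul_cancel₀ hpos.ne']
  exact (h hs).2 hint

/-- The linear map that sends the standard basis to a given basis. -/
noncomputable def linearEquivOfBasis (P S : Plane) (hD : P 0 * S 1 - P 1 * S 0 ≠ 0) :
    Plane ≃ₗ[ℝ] Plane where
  toFun x := x 0 • P + x 1 • S
  invFun y := !₂[(S 1 * y 0 - S 0 * y 1) / (P 0 * S 1 - P 1 * S 0),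
    (P 0 * y 1 - P 1 * y 0) / (P 0 * S 1 - P 1 * S 0)]
  map_add' x y := by apply plane_ext <;> simp <;> ring
  map_smul' c x := by apply plane_ext <;> simp <;> ring
  left_inv x := by apply plane_ext <;> simp <;> rw [div_eq_iff hD] <;> ring
  right_inv y := by
    apply plane_ext <;> simp <;>
      rw [div_mul_eq_mul_div, div_mul_eq_mul_div, ← add_div, div_eq_iff hD] <;> ring

lemma exists_eq_dir_of_norm_eq_one {x : Plane} (hx : ‖x‖ = 1) : ∃ φ, x = dir φ := by
  have h := norm_sq_eq x
  rw [hx] at h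
  have hz : ‖(⟨x 0, x 1⟩ : ℂ)‖ = 1 := by
    rw [Complex.norm_def, Complex.normSq_mk, ← pow_two, ← pow_two, ← h]; simp
  refine ⟨Complex.arg ⟨x 0, x 1⟩, ?_⟩
  have hc := Complex.norm_mul_cos_arg ⟨x 0, x 1⟩
  have hs := Complex.norm_mul_sin_arg ⟨x 0, x 1⟩
  rw [hz, one_mul] at hc hs
  apply plane_ext
  · rw [dir_zero_apply, hc]
  · rw [dir_one_apply, hs]

/-- A convex body whose boundary contains an ellipse is an ellipse. -/
lemma isEllipse_of_subset_frontier {K : Set Plane} (hK : Convex ℝ K) (hc : IsClosed K)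
    {z P S : Plane} (hD : P 0 * S 1 - P 1 * S 0 ≠ 0)
    (h : ∀ φ, z + (Real.cos φ • P + Real.sin φ • S) ∈ frontier K) : IsEllipse K := by
  let A : Plane ≃ᵃ[ℝ] Plane :=
    (linearEquivOfBasis P S hD).toAffineEquiv.trans (AffineEquiv.constVAdd ℝ Plane z)
  have hA : ∀ x, A x = z + (x 0 • P + x 1 • S) := fun x => rfl
  let Φ := (AffineEquiv.toContinuousAffineEquiv A).toHomeomorph
  have hΦ : ∀ x, Φ x = A x := fun x => rfl
  refine ⟨A, ?_⟩
  have hball : Metric.closedBall 0 1 = A ⁻¹' K := by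
    apply closedBall_eq_of_sphere_subset_frontier
    · exact hK.affine_preimage A.toAffineMap
    · exact hc.preimage Φ.continuous
    · intro x hx
      rw [mem_sphere_zero_iff_norm] at hx
      obtain ⟨φ, rfl⟩ := exists_eq_dir_of_norm_eq_one hx
      have h1 : frontier (Φ ⁻¹' K) = Φ ⁻¹' frontier K := (Φ.preimage_frontier K).symm
      have h2 : dir φ ∈ frontier (Φ ⁻¹' K) := by
        rw [h1, mem_preimage, hΦ, hA, dir_zero_apply, dir_one_apply]
        exact h φ
      exact h2
  rw [hball]
  exact image_preimage_eq K A.surjective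

/-- A moving pair of vectors that rotates into itself with angular velocity bounded below. -/
lemma exists_rotating_pair {e f : ℝ → Plane} {ω : ℝ → ℝ} (hω : Continuous ω) {ω₀ : ℝ}
    (hω₀ : 0 < ω₀) (hle : ∀ t, ω₀ ≤ ω t) (he : ∀ t, HasDerivAt e (ω t • f t) t)
    (hf : ∀ t, HasDerivAt f (-ω t • e t) t) (φ : ℝ) :
    ∃ t, e t = Real.cos φ • e 0 + Real.sin φ • f 0 ∧
      f t = -Real.sin φ • e 0 + Real.cos φ • f 0 := by
  -- The angle of rotation up to time `t`. It takes every value because its speed is at least `ω₀`;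
  -- turning the pair back by `τ t` gives constant vectors.
  set τ : ℝ → ℝ := fun t => ∫ s in (0 : ℝ)..t, ω s with hτ
  have hτd : ∀ t, HasDerivAt τ (ω t) t := fun t => hω.integral_hasStrictDerivAt 0 t |>.hasDerivAt
  have hτ0 : τ 0 = 0 := intervalIntegral.integral_same
  have hmono : Monotone fun t => τ t - ω₀ * t := by
    refine monotone_of_hasDerivAt_nonneg (f' := fun t => ω t - ω₀ * 1) (fun t =>
      (hτd t).fun_sub ((hasDerivAt_id t).const_mul ω₀)) fun t => ?_
    simp [hle t]
  have hsurj : Function.Surjective τ := by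
    refine Continuous.surjective (continuous_iff_continuousAt.2 fun t => (hτd t).continuousAt) ?_ ?_
    · refine tendsto_atTop_mono' _ ?_ (tendsto_id.const_mul_atTop hω₀)
      filter_upwards [eventually_ge_atTop 0] with t ht
      have := hmono ht
      simp only [hτ0, mul_zero, sub_zero] at this
      simp only [id]
      linarith
    · refine tendsto_atBot_mono' _ ?_ (tendsto_id.const_mul_atBot hω₀)
      filter_upwards [eventually_le_atBot 0] with t ht
      have := hmono ht
      simp only [hτ0, mul_zero, sub_zero] at this
      simp only [id]
      linarith
  have hP : ∀ t, Real.cos (τ t) • e t - Real.sin (τ t) • f t = e 0 := by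
    intro t
    have hd : ∀ t, HasDerivAt (fun t => Real.cos (τ t) • e t - Real.sin (τ t) • f t) 0 t := by
      intro t
      have := ((hτd t).cos.smul (he t)).sub ((hτd t).sin.smul (hf t))
      convert! this using 1
      module
    have := is_const_of_deriv_eq_zero (fun t => (hd t).differentiableAt)
      (fun t => (hd t).deriv) t 0
    simpa [hτ0] using this
  have hS : ∀ t, Real.sin (τ t) • e t + Real.cos (τ t) • f t = f 0 := by
    intro t
    have hd : ∀ t, HasDerivAt (fun t => Real.sin (τ t) • e t + Real.cos (τ t) • f t) 0 t := by
      intro t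
      have := ((hτd t).sin.smul (he t)).add ((hτd t).cos.smul (hf t))
      convert! this using 1
      module
    have := is_const_of_deriv_eq_zero (fun t => (hd t).differentiableAt)
      (fun t => (hd t).deriv) t 0
    simpa [hτ0] using this
  obtain ⟨t, rfl⟩ := hsurj φ
  have hcs := Real.cos_sq_add_sin_sq (τ t)
  refine ⟨t, ?_, ?_⟩
  · rw [← hP t, ← hS t]
    apply plane_ext <;> simp
    · linear_combination (-(e t 0)) * hcs
    · linear_combination (-(e t 1)) * hcs
  · rw [← hP t, ← hS t]
    apply plane_ext <;> simp
    · linear_combination (-(f t 0)) * hcs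
    · linear_combination (-(f t 1)) * hcs

/-- If the curves of flotation and buoyancy are homothetic for all areas in an interval, with the
same orientation of the tangents, then the body is an ellipse. -/
theorem isEllipse_of_tangential {K : Set Plane} (hK : Convex ℝ K) (hc : IsCompact K) {δ : ℝ}
    (hδ : δ ∈ Ioo 0 (volume.real K)) (h : ∀ᶠ d in 𝓝 δ, IsTangential K 0 d) : IsEllipse K := by
  have hδ0 := hδ.1
  obtain ⟨A, B, v, -, hU⟩ := exists_inv_len_eq hK hc hδ (Or.inl rfl) h
  obtain ⟨r, w, hrw⟩ := h.self_of_nhds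
  have hpt := pt_eq_of_tangential hK hc hδ (Or.inl rfl) hrw
  simp only [add_zero] at hU hpt
  set α := A + B with hα
  set b := centroid K δ with hb
  set e : ℝ → Plane := fun θ => α • b θ + v with he
  set u : ℝ → ℝ := fun θ => (len K δ θ)⁻¹ with hu
  set u' : ℝ → ℝ := fun θ => inner ℝ (nor θ) (e θ) with hu'
  have hupos : ∀ θ, 0 < u θ := fun θ => inv_pos.2 (len_pos hK hc hδ θ)
  have hue : ∀ θ, u θ = inner ℝ (dir θ) (e θ) := fun θ => by
    simp only [hu, hU, he, hα, add_smul]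
  have hlen : ∀ θ, len K δ θ ^ 3 / (12 * δ) = (12 * δ)⁻¹ / u θ ^ 3 := fun θ => by
    have := len_pos hK hc hδ θ
    simp only [hu]
    field_simp
  have hed : ∀ θ, HasDerivAt e (-(α * (12 * δ)⁻¹ / u θ ^ 3) • nor θ) θ := fun θ => by
    have := ((hasDerivAt_centroid hK hc hδ θ).const_smul α).add_const v
    convert! this using 1
    rw [hlen, smul_smul]
    congr 1
    ring
  have hud : ∀ θ, HasDerivAt u (u' θ) θ := fun θ => by
    have := (hasDerivAt_dir θ).inner ℝ (hed θ)
    convert! this using 1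
    · ext t; exact hue t
    · simp [hu', inner_smul_right, inner_dir_nor]
  have hud' : ∀ θ, HasDerivAt u' (-u θ - α * (12 * δ)⁻¹ / u θ ^ 3) θ := fun θ => by
    have := (hasDerivAt_nor θ).inner ℝ (hed θ)
    convert! this using 1
    rw [inner_smul_right, inner_nor_nor, inner_neg_left, hue, sub_self, Real.cos_zero]
    ring
  have huc : Continuous u := continuous_iff_continuousAt.2 fun t => (hud t).continuousAt
  have huper : ∀ θ, u (θ + 2 * Real.pi) = u θ := fun θ => by simp only [hu, len_add_two_pi]
  -- At a minimum of `u` the equation gives `0 ≤ u'' = -u - α * (12 * δ)⁻¹ / u ^ 3`.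
  have hα0 : α < 0 := by
    obtain ⟨x₀, hx₀⟩ := exists_forall_le_of_periodic huc.neg Real.two_pi_pos
      (fun x => by rw [Pi.neg_apply, Pi.neg_apply, huper])
    have h1 := second_deriv_nonpos_of_forall_le (fun x => (hud x).neg) hx₀ (hud' x₀).neg
    have h2 := hupos x₀
    by_contra! h3
    have : 0 ≤ α * (12 * δ)⁻¹ / u x₀ ^ 3 := by positivity
    linarith
  obtain ⟨c, hc0, hcα⟩ : ∃ c : ℝ, 0 < c ∧ c ^ 2 = -(α * (12 * δ)⁻¹) := by
    have : 0 < -(α * (12 * δ)⁻¹) := by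
      rw [← neg_mul]; exact mul_pos (by linarith) (by positivity)
    exact ⟨_, Real.sqrt_pos.2 this, Real.sq_sqrt this.le⟩
  -- The companion of `e` normalized so that `e' = ω f` and `f' = -ω e`; the second identity uses
  -- only `e = u • dir + u' • nor`.
  set f : ℝ → Plane := fun θ => (c / u θ) • nor θ with hf
  set ω : ℝ → ℝ := fun θ => c / u θ ^ 2 with hω
  have hedec : ∀ θ, e θ = u θ • dir θ + u' θ • nor θ := fun θ => by
    rw [hue]; exact (pt_inner θ (e θ)).symm
  have hed2 : ∀ θ, HasDerivAt e (ω θ • f θ) θ := fun θ => by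
    convert! hed θ using 1
    rw [hf, hω, smul_smul]
    congr 1
    have := (hupos θ).ne'
    rw [← neg_div, ← hcα]
    field_simp
  have hfd : ∀ θ, HasDerivAt f (-ω θ • e θ) θ := fun θ => by
    have hne := (hupos θ).ne'
    have := ((hasDerivAt_const θ c).fun_div (hud θ) hne).smul (hasDerivAt_nor θ)
    convert! this using 1
    rw [hedec, hω]
    apply plane_ext <;> simp <;> field_simp
  have hωc : Continuous ω := continuous_const.div (huc.pow 2) fun θ => (pow_pos (hupos θ) 2).ne'
  obtain ⟨x₁, hx₁⟩ := exists_forall_le_of_periodic huc Real.two_pi_pos huper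
  have hrot := exists_rotating_pair hωc (ω₀ := c / u x₁ ^ 2) (div_pos hc0 (pow_pos (hupos x₁) 2))
    (fun t => by
      have := hupos t
      have := hx₁ t
      simp only [hω]
      gcongr) hed2 hfd
  -- A chord endpoint is the midpoint `r • b + w` plus `(len / 2) • nor`. Here `b = α⁻¹ • (e - v)`,
  -- and `len / 2 = 1 / (2 * u)` is `μ` times the factor `c / u` in `f`.
  set κ := r / α with hκ
  set μ := 1 / (2 * c) with hμ
  have hfr : ∀ θ, (w - κ • v) + (κ • e θ + μ • f θ) ∈ frontier K := by
    intro θ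
    have h1 := pt_mem_frontier hK hc hδ θ (Or.inr rfl)
    convert! h1 using 1
    have h2 : pt θ (level K δ θ) (mid K δ θ + len K δ θ / 2) =
        pt θ (level K δ θ) (mid K δ θ) + (len K δ θ / 2) • nor θ := by
      simp only [pt, add_smul, add_assoc]
    have h3 : μ • f θ = (len K δ θ / 2) • nor θ := by
      simp only [hf, hμ, hu, smul_smul]
      congr 1
      have := len_pos hK hc hδ θ
      field_simp
    have h4 : κ • e θ = r • b θ + κ • v := by
      simp only [he, smul_add, smul_smul, hκ, div_mul_cancel₀ r hα0.ne]
    rw [h2, hpt, h3, h4]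
    abel
  -- Amplitude and phase of `κ • e + μ • f`: with `(κ, μ) = s (cos β, sin β)` the endpoint at
  -- rotation angle `φ - β` is the point of parameter `φ` on the ellipse spanned by `s • e 0` and `s
  -- • f 0`.
  set s := Real.sqrt (κ ^ 2 + μ ^ 2) with hs
  have hμ0 : 0 < μ := by positivity
  have hs2 : s ^ 2 = κ ^ 2 + μ ^ 2 := Real.sq_sqrt (by positivity)
  have hs0 : 0 < s := Real.sqrt_pos.2 (by positivity)
  obtain ⟨β, hβ⟩ := exists_eq_dir_of_norm_eq_one (x := !₂[κ / s, μ / s]) (by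
    have h1 := norm_sq_eq !₂[κ / s, μ / s]
    have h2 : ‖(!₂[κ / s, μ / s] : Plane)‖ ^ 2 = 1 := by
      rw [h1]
      simp only [Matrix.cons_val_zero, Matrix.cons_val_one]
      field_simp
      linarith
    exact (pow_eq_one_iff_of_nonneg (norm_nonneg _) two_ne_zero).1 h2)
  have hβ0 : κ = s * Real.cos β := by
    have := congrArg (fun x : Plane => x 0) hβ
    simp only [dir_zero_apply, Matrix.cons_val_zero] at this
    rw [← this]; field_simp
  have hβ1 : μ = s * Real.sin β := by
    have := congrArg (fun x : Plane => x 1) hβ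
    simp only [dir_one_apply, Matrix.cons_val_one, Matrix.cons_val_fin_one] at this
    rw [← this]; field_simp
  refine isEllipse_of_subset_frontier hK hc.isClosed (z := w - κ • v) (P := s • e 0)
    (S := s • f 0) ?_ fun φ => ?_
  · have h0 : e 0 0 * f 0 1 - e 0 1 * f 0 0 = c := by
      rw [hedec 0, hf]
      have := (hupos 0).ne'
      simp
      field_simp
    have h1 : (s • e 0) 0 * (s • f 0) 1 - (s • e 0) 1 * (s • f 0) 0 = s ^ 2 * c := by
      rw [← h0]; simp; ring
    rw [h1]
    positivity
  · obtain ⟨t, ht1, ht2⟩ := hrot (φ - β)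
    convert! hfr t using 2
    rw [ht1, ht2, hβ0, hβ1, Real.cos_sub, Real.sin_sub]
    have hcs := Real.cos_sq_add_sin_sq β
    apply plane_ext <;> simp
    · linear_combination (-s * (Real.cos φ * e 0 0 + Real.sin φ * f 0 0)) * hcs
    · linear_combination (-s * (Real.cos φ * e 0 1 + Real.sin φ * f 0 1)) * hcs

/-! ### From homothety to tangency, and the density argument -/

section

variable {K : Set Plane} (hK : Convex ℝ K) (hc : IsCompact K) {δ : ℝ}
  (hδ : δ ∈ Ioo 0 (volume.real K))

include hc

lemma area_add_pi (θ s : ℝ) : area K (θ + Real.pi) (-s) = volume.real K - area K θ s := by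
  have h1 := measureReal_inter_add_sdiff (μ := volume) (s := K) (t := halfPlane (dir θ) s)
    (isClosed_halfPlane _ _).measurableSet hc.measure_ne_top
  have h2 : volume.real (K \ halfPlane (dir θ) s) = area K (θ + Real.pi) (-s) := by
    apply measureReal_congr
    filter_upwards [measure_eq_zero_iff_ae_notMem.1 (volume_line θ s)] with x hx
    refine propext (and_congr_right fun _ => ?_)
    change ¬ inner ℝ (dir θ) x ≤ s ↔ inner ℝ (dir (θ + Real.pi)) x ≤ -s
    rw [dir_add_pi, inner_neg_left, neg_le_neg_iff, not_le]
    exact ⟨le_of_lt, fun h => lt_of_le_of_ne h (Ne.symm hx)⟩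
  rw [← h2, ← h1, area]
  ring

include hδ

lemma level_add_pi_ne (h : δ ≠ volume.real K / 2) (θ : ℝ) :
    level K δ (θ + Real.pi) ≠ -level K δ θ := by
  intro heq
  have h1 := area_level hc hδ (θ + Real.pi)
  rw [heq, area_add_pi hc, area_level hc hδ] at h1
  exact h (by linarith)

include hK

lemma pt_mem_flotationCurve (θ : ℝ) :
    pt θ (level K δ θ) (mid K δ θ) ∈ flotationCurve K δ := by
  refine ⟨level K δ, fun φ => (cutsOff_iff hK hc hδ φ).2 rfl, θ, ?_, ?_⟩
  · simp only [inner_dir_pt_self, sub_self]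
  · have := ((hasDerivAt_dir θ).inner ℝ (hasDerivAt_const θ
      (pt θ (level K δ θ) (mid K δ θ)))).fun_sub (hasDerivAt_level hK hc hδ θ)
    convert! this using 1
    simp only [pt, inner_add_right, inner_smul_right, inner_nor_dir, inner_nor_nor]
    simp

/-- With `pt_mem_flotationCurve` this places the homothetic image of every chord midpoint on the
curve `centroid K δ`; these two inclusions are all that the rigidity argument needs. -/
lemma buoyancyCurve_subset : buoyancyCurve K δ ⊆ range (centroid K δ) := by
  rintro _ ⟨θ, s, hs, rfl⟩
  rw [cutsOff_iff hK hc hδ] at hs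
  exact ⟨θ, by rw [hs, average_eq_centroid hc hδ]⟩

/-- If the curves of flotation and buoyancy are homothetic, then parallel tangents correspond to
each other. -/
lemma isTangential_of_homothetic (hne : δ ≠ volume.real K / 2)
    (h : Homothetic (flotationCurve K δ) (buoyancyCurve K δ)) :
    IsTangential K 0 δ ∨ IsTangential K Real.pi δ := by
  obtain ⟨z, r, hr, himg⟩ := h
  set v := (1 - r) • z with hv
  have hpt : ∀ θ, AffineMap.homothety z r (pt θ (level K δ θ) (mid K δ θ)) =
      pt θ (r * level K δ θ + inner ℝ (dir θ) v) (r * mid K δ θ + inner ℝ (nor θ) v) := by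
    intro θ
    have h1 : pt θ (r * level K δ θ + inner ℝ (dir θ) v) (r * mid K δ θ + inner ℝ (nor θ) v) =
        r • pt θ (level K δ θ) (mid K δ θ) + pt θ (inner ℝ (dir θ) v) (inner ℝ (nor θ) v) := by
      simp only [pt, add_smul, smul_add, mul_smul]; abel
    rw [h1, pt_inner, AffineMap.homothety_apply, vsub_eq_sub, vadd_eq_add, hv]
    module
  have hk : ∀ θ, HasDerivAt (fun t => r * level K δ t + inner ℝ (dir t) v)
      (r * mid K δ θ + inner ℝ (nor θ) v) θ := fun θ => by
    have := ((hasDerivAt_level hK hc hδ θ).const_mul r).add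
      ((hasDerivAt_dir θ).inner ℝ (hasDerivAt_const θ v))
    rwa [inner_zero_right, zero_add] at this
  have hrig := envelope_rigidity (hasDerivAt_centroid hK hc hδ) (curvature_radius_pos hK hc hδ)
    (centroid_add_two_pi K δ) hk
    ((continuous_const.mul (continuous_mid hK hc hδ)).add (continuous_nor.inner continuous_const))
    (fun θ => buoyancyCurve_subset hK hc hδ (by
      rw [← hpt, ← himg]
      exact mem_image_of_mem _ (pt_mem_flotationCurve hK hc hδ θ)))
    (fun θ heq => level_add_pi_ne hc hδ hne θ (by
      rw [dir_add_pi, inner_neg_left] at heq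
      have : r * level K δ (θ + Real.pi) = r * -level K δ θ := by linarith
      exact mul_left_cancel₀ hr this))
  refine hrig.imp (fun h => ?_) (fun h => ?_)
  all_goals
    refine ⟨r⁻¹, -(r⁻¹ • v), fun θ => ?_⟩
    have := h θ
    simp only [add_zero, inner_add_right, inner_smul_right, inner_neg_right]
    rw [← this]
    field_simp
    ring

/-- Tangency is a family of equations in `θ` whose two sides, with the forced `ratio` and `shift`,
are continuous in `δ`; failure at a single angle persists. -/
lemma eventually_not_isTangential {σ : ℝ} (hσ : σ = 0 ∨ σ = Real.pi)
    (h : ¬ IsTangential K σ δ) : ∀ᶠ d in 𝓝 δ, ¬ IsTangential K σ d := by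
  rw [isTangential_iff hK hc hδ hσ] at h
  push Not at h
  obtain ⟨θ, hθ⟩ := h
  have h1 : ContinuousAt (fun d => level K d θ) δ :=
    (hasDerivAt_level_area hK hc hδ θ).continuousAt
  have h2 : ContinuousAt (fun d => inner ℝ (dir θ)
      (ratio K σ d • centroid K d (θ + σ) + shift K σ d)) δ :=
    continuousAt_const.inner
      (((differentiableAt_ratio hK hc hδ hσ).continuousAt.smul
        (hasDerivAt_centroid_area hK hc hδ (θ + σ)).continuousAt).add
          (differentiableAt_shift hK hc hδ hσ).continuousAt)
  filter_upwards [(h1.sub h2).eventually_ne (sub_ne_zero.2 hθ), isOpen_Ioo.mem_nhds hδ] with d hd hd' ht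
  exact hd (sub_eq_zero.2 ((isTangential_iff hK hc hd' hσ).1 ht θ))

end

/-- A compact convex set whose curves of flotation and buoyancy are homothetic for a somewhere
dense set of areas is an ellipse. -/
theorem isNowhereDense_setOf_homothetic {C : Set Plane} (hconv : Convex ℝ C) (hcomp : IsCompact C)
    (hC : ¬ IsEllipse C) :
    IsNowhereDense {δ : Ioo (0 : ℝ) (volume C).toReal |
      Homothetic (flotationCurve C δ) (buoyancyCurve C δ)} := by
  set V := (volume C).toReal with hV
  set S := {δ : Ioo (0 : ℝ) V | Homothetic (flotationCurve C δ) (buoyancyCurve C δ)} with hS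
  rw [IsNowhereDense, eq_empty_iff_forall_notMem]
  intro x₀ hx₀
  -- Half the area is removed because rigidity fails to apply there: opposite water lines may
  -- coincide. Deleting one point keeps the set open and non-empty.
  set W : Set ℝ := Subtype.val '' interior (closure S) \ {V / 2} with hW
  have hWo : IsOpen W := by
    refine IsOpen.sdiff ?_ isClosed_singleton
    exact isOpen_Ioo.isOpenEmbedding_subtypeVal.isOpenMap _ isOpen_interior
  have hWV : ∀ d ∈ W, d ∈ Ioo 0 V := by
    rintro _ ⟨⟨d, -, rfl⟩, -⟩
    exact d.2
  have hWne : W.Nonempty := by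
    exact (dense_compl_singleton (V / 2)).inter_open_nonempty _
      (isOpen_Ioo.isOpenEmbedding_subtypeVal.isOpenMap _ isOpen_interior) ⟨_, x₀, hx₀, rfl⟩
  have hor : ∀ d ∈ W, IsTangential C 0 d ∨ IsTangential C Real.pi d := by
    intro d hd
    by_contra! hcon
    have hev := (eventually_not_isTangential hconv hcomp (hWV d hd) (Or.inl rfl) hcon.1).and
      ((eventually_not_isTangential hconv hcomp (hWV d hd) (Or.inr rfl) hcon.2).and
        (hWo.mem_nhds hd))
    obtain ⟨⟨y, hy, rfl⟩, -⟩ := hd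
    have hfr := mem_closure_iff_frequently.1 (interior_subset hy)
    obtain ⟨t, htS, ht0, htπ, htW⟩ :=
      (hfr.and_eventually (continuous_subtype_val.continuousAt.eventually hev)).exists
    rcases isTangential_of_homothetic hconv hcomp (hWV _ htW) htW.2 htS with h | h
    · exact ht0 h
    · exact htπ h
  -- If the case `σ = 0` failed at `d`, it would fail nearby, so the case `σ = π` would hold on a
  -- neighbourhood, and that yields `σ = 0` at `d`.
  have hzero : ∀ d ∈ W, IsTangential C 0 d := by
    intro d hd
    by_contra hcon
    refine hcon (isTangential_zero_of_pi hconv hcomp (hWV d hd) ?_)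
    filter_upwards [eventually_not_isTangential hconv hcomp (hWV d hd) (Or.inl rfl) hcon,
      hWo.mem_nhds hd] with t ht htW
    exact (hor t htW).resolve_left ht
  obtain ⟨d, hd⟩ := hWne
  exact hC (isEllipse_of_tangential hconv hcomp (hWV d hd)
    (mem_of_superset (hWo.mem_nhds hd) hzero))

end Flotation

theorem mainTheorem11 (K : ConvexBody Flotation.Plane)
    (hint : (interior (K : Set Flotation.Plane)).Nonempty)
    (hC2 : Flotation.HasC2Boundary (K : Set Flotation.Plane))
    (hK : ¬ Flotation.IsEllipse (K : Set Flotation.Plane)) :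
    IsNowhereDense {δ : Set.Ioo (0 : ℝ) (MeasureTheory.volume (K : Set Flotation.Plane)).toReal |
      Flotation.Homothetic (Flotation.flotationCurve (K : Set Flotation.Plane) δ)
        (Flotation.buoyancyCurve (K : Set Flotation.Plane) δ)} := by
  exact Flotation.isNowhereDense_setOf_homothetic K.convex K.isCompact hK
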